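/- **Setting.** Let $I,J$ be disjoint index sets, $n\ge 1$, and $\alpha\colon\{1,\dots,n\}\to I\sqcup J$. A non-commutative probability space $(\mathcal A,\varphi)$ is a unital complex algebra with a linear functional $\varphi$, $\varphi(1)=1$; a two-faced family in it is $z=((z_i)_{i\in I},(z_j)_{j\in J})$, $z_k\in\mathcal A$. *Bi-non-crossing partitions.* For $\chi\in\{\ell,r\}^n$ let $i_1<\dots<i_p$ be the elements of $\chi^{-1}(\ell)$, $j_1<\dots<j_{n-p}$ those of $\chi^{-1}(r)$, and let $s_\chi\in S_n$ be given by $s_\chi(k)=i_k$ for $k\le p$ and $s_\chi(k)=j_{n+1-k}$ for $k>p$. $BNC(\chi)$ is the set, ordered by refinement, of all partitions $\pi$ of $\{1,\dots,n\}$ such that $s_\chi^{-1}\cdot\pi$ is non-crossing; $1_\chi$ is its maximum $\{\{1,\dots,n\}\}$, and $\mu_{BNC}$ is its Möbius function. For $\alpha$ as above let $\chi_k=\ell$ if $\alpha(k)\in I$ and $\chi_k=r$ otherwise, and write $BNC(\alpha)=BNC(\chi)$, $1_\alpha=1_\chi$. *Cumulants.* The cumulants $\kappa_\chi\colon\mathcal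 A^n\to\mathbb C$ ($n\ge1$, $\chi\in\{\ell,r\}^n$) are the functions determined recursively by $\varphi(T_1\cdots T_n)=\sum_{\pi\in BNC(\chi)}\prod_{V\in\pi}\kappa_{\chi|_V}((T_1,\dots,T_n)|_V)$. Put $\kappa_\alpha(z)=\kappa_\chi(z_{\alpha(1)},\dots,z_{\alpha(n)})$ with the $\chi$ of $\alpha$. *Bi-freeness.* For vector spaces $\mathcal X^\epsilon=\mathbb C\xi^\epsilon\oplus\mathring{\mathcal X}^\epsilon$ ($\epsilon\in\{',''\}$) with state-vectors, the free product is $\mathcal X=\mathbb C\xi\oplus\bigoplus_{m\ge1}\bigoplus_{\epsilon_1\ne\cdots\ne\epsilon_m}\mathring{\mathcal X}^{\epsilon_1}\otimes\cdots\otimes\mathring{\mathcal X}^{\epsilon_m}$, with the state on $\mathcal L(\mathcal X)$ that maps $S$ to the coefficient of $\xi$ in $S\xi$; the left representation $\lambda^\epsilon$ (right representation $\rho^\epsilon$) of $\mathcal L(\mathcal X^\epsilon)$ lets an operator act on the leftmost (rightmost) tensor factor in $\mathcal X^\epsilon$, where $\xi^\epsilon\otimes v$ (resp. $v\otimes\xi^\epsilon$)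 is identified with $v$. Two-faced families $z',z''$ in $(\mathcal A,\varphi)$ are bi-free if there are $\mathcal X',\mathcal X''$ and unital homomorphisms $l^\epsilon\colon\mathbb C\langle z_i^\epsilon: i\in I\rangle\to\mathcal L(\mathcal X^\epsilon)$, $r^\epsilon\colon\mathbb C\langle z_j^\epsilon: j\in J\rangle\to\mathcal L(\mathcal X^\epsilon)$, defined on non-commutative polynomial algebras, such that the families $((\lambda^\epsilon(l^\epsilon(z_i^\epsilon)))_{i\in I},(\rho^\epsilon(r^\epsilon(z_j^\epsilon)))_{j\in J})$, $\epsilon\in\{',''\}$, have the same joint distribution in $\mathcal L(\mathcal X)$ as $z',z''$. **Proposition.** In the polynomial ring over $\mathbb C$ in commuting indeterminates $X_K$, $\emptyset\ne K\subseteq\{1,\dots,n\}$, where $X_K$ has degree $|K|$, let $$R_\alpha=\sum_{\pi\in BNC(\alpha)}\mu_{BNC}(\pi,1_\alpha)\prod_{V\in\pi}X_V .$$ For a polynomial $P$ in the $X_K$ and a two-faced family $z$ in $(\mathcal A,\varphi)$ let $P(z)$ be the value of $P$ at $X_{\{k_1<\dots<k_r\}}=\varphi(z_{\alpha(k_1)}\cdots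 z_{\alpha(k_r)})$. Then: 1. $R_\alpha$ is homogeneous of degree $n$. 2. $R_\alpha(z)=\kappa_\alpha(z)$ for every two-faced family $z$ in every non-commutative probability space. 3. If $z'$ and $z''$ are bi-free in $(\mathcal A,\varphi)$, then $R_\alpha(z'+z'')=R_\alpha(z')+R_\alpha(z'')$. 4. $R_\alpha$ is Voiculescu's universal bi-free cumulant polynomial. That is, it has the defining properties: (i) $R_\alpha=X_{\{1,\dots,n\}}+\tilde R_\alpha$, where $\tilde R_\alpha$ is a polynomial in the $X_K$ with $K\subsetneq\{1,\dots,n\}$; (ii) $R_\alpha$ and $\tilde R_\alpha$ are homogeneous of degree $n$; (iii) the additivity in 3. Moreover, if a polynomial $P$ has the properties (i)–(iii), then $P(z)=R_\alpha(z)$ for every two-faced family $z$ in every non-commutative probability space, and $P=R_\alpha$ as polynomials if $\alpha$ is injective. -/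

import Mathlib

open Finset

/-! ### Bi-non-crossing partitions -/

/-- The two faces: left variables are indexed by `I`, right variables by `J`. -/
inductive Face
  | left
  | right
  deriving DecidableEq

/-- The face of an index in `I ⊔ J`. -/
def faceOf {I J : Type*} : I ⊕ J → Face :=
  Sum.elim (fun _ => Face.left) (fun _ => Face.right)

/-- The set of nodes of `{1, …, n}` (here `Fin n`) that lie on a given face. -/
def nodesOn {n : ℕ} (χ : Fin n → Face) (f : Face) : Finset (Fin n) :=
  univ.filter fun k => χ k = f

theorem card_nodesOn {n : ℕ} (χ : Fin n → Face) :
    (nodesOn χ Face.left).card + (nodesOn χ Face.right).card = n := by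
  have h : nodesOn χ Face.right = univ.filter fun k => ¬ χ k = Face.left := by
    ext k
    cases hk : χ k <;> simp [nodesOn, hk]
  rw [h, nodesOn, Finset.card_filter_add_card_filter_not]
  simp

/-- The map `s_χ`: it lists the left nodes in increasing order and then the right nodes in
decreasing order. (Positions are counted from `0`, so the `k`-th position with `k ≥ p` receives
the right node with number `n - 1 - k`.) -/
def sFun {n : ℕ} (χ : Fin n → Face) (k : Fin n) : Fin n :=
  if h : (k : ℕ) < (nodesOn χ Face.left).card then
    (nodesOn χ Face.left).orderEmbOfFin rfl ⟨k, h⟩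
  else
    (nodesOn χ Face.right).orderEmbOfFin rfl
      ⟨n - 1 - k, by have h1 := card_nodesOn χ; have h2 := k.2; omega⟩

theorem sFun_injective {n : ℕ} (χ : Fin n → Face) : Function.Injective (sFun χ) := by
  have hl : ∀ i, χ ((nodesOn χ Face.left).orderEmbOfFin rfl i) = Face.left := fun i => by
    simpa [nodesOn] using (nodesOn χ Face.left).orderEmbOfFin_mem rfl i
  have hr : ∀ i, χ ((nodesOn χ Face.right).orderEmbOfFin rfl i) = Face.right := fun i => by
    simpa [nodesOn] using (nodesOn χ Face.right).orderEmbOfFin_mem rfl i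
  intro a b hab
  unfold sFun at hab
  split_ifs at hab with h1 h2 h2
  · have := (nodesOn χ Face.left).orderEmbOfFin rfl |>.injective hab
    simp only [Fin.mk.injEq] at this
    exact Fin.ext this
  · have := congrArg χ hab
    rw [hl, hr] at this
    cases this
  · have := congrArg χ hab
    rw [hl, hr] at this
    cases this
  · have := (nodesOn χ Face.right).orderEmbOfFin rfl |>.injective hab
    simp only [Fin.mk.injEq] at this
    apply Fin.ext
    omega

/-- The permutation `s_χ` of `{1, …, n}`. -/
noncomputable def sPerm {n : ℕ} (χ : Fin n → Face) : Equiv.Perm (Fin n) :=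
  Equiv.ofBijective (sFun χ) (Finite.injective_iff_bijective.mp (sFun_injective χ))

/-- A family of blocks is non-crossing if there are no `a < b < c < d` with `a, c` in one block
and `b, d` in another one. -/
def IsNonCrossing {n : ℕ} (P : Finset (Finset (Fin n))) : Prop :=
  ∀ V ∈ P, ∀ W ∈ P, V ≠ W →
    ∀ a ∈ V, ∀ b ∈ W, ∀ c ∈ V, ∀ d ∈ W, ¬ (a < b ∧ b < c ∧ c < d)

/-- The partition `π` is bi-non-crossing if `s_χ⁻¹ · π` is non-crossing. -/
def IsBiNonCrossing {n : ℕ} (χ : Fin n → Face)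
    (π : Finpartition (univ : Finset (Fin n))) : Prop :=
  IsNonCrossing (π.parts.image fun V => V.image (sPerm χ).symm)

/-- The partially ordered set `BNC(χ)` (order: refinement). -/
abbrev BNC {n : ℕ} (χ : Fin n → Face) : Type :=
  {π : Finpartition (univ : Finset (Fin n)) // IsBiNonCrossing χ π}

noncomputable instance {n : ℕ} (χ : Fin n → Face) : Fintype (BNC χ) :=
  Fintype.ofFinite _

noncomputable instance {n : ℕ} (χ : Fin n → Face) : LocallyFiniteOrder (BNC χ) :=
  @Fintype.toLocallyFiniteOrder _ _ _ (Classical.decRel _) (Classical.decRel _)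

noncomputable instance {n : ℕ} (χ : Fin n → Face) : DecidableEq (BNC χ) :=
  Classical.decEq _

/-- The maximum `1_χ` of `BNC(χ)`, the partition with one block (if `n ≥ 1`). -/
noncomputable def oneBNC {n : ℕ} (χ : Fin n → Face) : BNC χ :=
  ⟨⊤, by
    intro V hV W hW hne
    obtain ⟨V', hV', rfl⟩ := Finset.mem_image.mp hV
    obtain ⟨W', hW', rfl⟩ := Finset.mem_image.mp hW
    have h1 := Finset.mem_singleton.mp (Finpartition.parts_top_subset _ hV')
    have h2 := Finset.mem_singleton.mp (Finpartition.parts_top_subset _ hW')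
    exact absurd (by rw [h1, h2]) hne⟩

theorem le_oneBNC {n : ℕ} (χ : Fin n → Face) (π : BNC χ) : π ≤ oneBNC χ :=
  show π.1 ≤ ⊤ from le_top

/-- The Möbius function of `BNC(χ)`, i.e. the inverse of the zeta function in the incidence
algebra. -/
noncomputable def muBNC {n : ℕ} (χ : Fin n → Face) (π σ : BNC χ) : ℂ :=
  IncidenceAlgebra.mu ℂ π σ

/-! ### Moments and cumulants -/

section Moments

variable {A : Type*} [Ring A] [Algebra ℂ A]

/-- The restriction `(T_{k_1}, …, T_{k_r})` of a tuple to `V = {k_1 < ⋯ < k_r}`. -/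
def restrictTo {n : ℕ} {B : Type*} (T : Fin n → B) (V : Finset (Fin n)) : Fin V.card → B :=
  fun i => T (V.orderEmbOfFin rfl i)

/-- The moment `φ(T_1 ⋯ T_n)`. -/
def moment (φ : A →ₗ[ℂ] ℂ) {n : ℕ} (T : Fin n → A) : ℂ :=
  φ (List.ofFn T).prod

theorem card_lt_of_ne_oneBNC {n : ℕ} {χ : Fin n → Face} {π : BNC χ} (h : π ≠ oneBNC χ)
    {V : Finset (Fin n)} (hV : V ∈ π.1.parts) : V.card < n := by
  have hle : V.card ≤ n := by simpa using Finset.card_le_univ V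
  refine lt_of_le_of_ne hle fun hc => h ?_
  have hU : V = univ := Finset.eq_univ_of_card V (by simpa using hc)
  refine le_antisymm (le_oneBNC χ π) ?_
  change (⊤ : Finpartition (univ : Finset (Fin n))) ≤ π.1
  intro W hW
  have hW' := Finset.mem_singleton.mp (Finpartition.parts_top_subset _ hW)
  exact ⟨V, hV, by rw [hW', hU]⟩

/-- The `(ℓ, r)`-cumulants `κ_χ(T_1, …, T_n)`, `n ≥ 1`: the solution, by recursion on `n`, of
`φ(T_1 ⋯ T_n) = ∑_{π ∈ BNC(χ)} ∏_{V ∈ π} κ_{χ|V}((T_1, …, T_n)|V)`; see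
`moment_eq_sum_cumulant`. -/
noncomputable def cumulant (φ : A →ₗ[ℂ] ℂ) (n : ℕ) (χ : Fin n → Face) (T : Fin n → A) : ℂ :=
  moment φ T -
    ∑ π : {π : BNC χ // π ≠ oneBNC χ}, ∏ V : {V : Finset (Fin n) // V ∈ π.1.1.parts},
      cumulant φ V.1.card (restrictTo χ V.1) (restrictTo T V.1)
termination_by n
decreasing_by exact card_lt_of_ne_oneBNC π.2 V.2

theorem cumulant_restrictTo_univ (φ : A →ₗ[ℂ] ℂ) (n : ℕ) (χ : Fin n → Face) (T : Fin n → A) :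
    cumulant φ (univ : Finset (Fin n)).card (restrictTo χ univ) (restrictTo T univ) =
      cumulant φ n χ T := by
  have key : ∀ (m : ℕ) (h : (univ : Finset (Fin n)).card = m) (hm : m = n),
      cumulant φ m (fun i => χ ((univ : Finset (Fin n)).orderEmbOfFin h i))
        (fun i => T ((univ : Finset (Fin n)).orderEmbOfFin h i)) = cumulant φ n χ T := by
    intro m h hm
    subst hm
    have : ∀ i, (univ : Finset (Fin m)).orderEmbOfFin h i = i := fun i => by
      have := Finset.orderEmbOfFin_unique (s := (univ : Finset (Fin m))) h (f := id)
        (fun _ => Finset.mem_univ _) strictMono_id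
      exact (congrFun this i).symm
    simp only [this]
  exact key _ rfl (by simp)

/-- The moment-cumulant formula that determines the cumulants. -/
theorem moment_eq_sum_cumulant (φ : A →ₗ[ℂ] ℂ) (n : ℕ) [NeZero n] (χ : Fin n → Face)
    (T : Fin n → A) :
    moment φ T = ∑ π : BNC χ, ∏ V ∈ π.1.parts,
      cumulant φ V.card (restrictTo χ V) (restrictTo T V) := by
  have h0 : (univ : Finset (Fin n)) ≠ ⊥ := Finset.univ_nonempty.ne_empty
  have hp : (oneBNC χ).1.parts = {univ} :=
    Finset.Nonempty.subset_singleton_iff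
      (Finpartition.parts_nonempty _ h0) |>.mp (Finpartition.parts_top_subset _)
  have hs := Fintype.sum_subtype_add_sum_subtype (fun π : BNC χ => π ≠ oneBNC χ)
    (fun π => ∏ V ∈ π.1.parts, cumulant φ V.card (restrictTo χ V) (restrictTo T V))
  have hu : ∑ π : {π : BNC χ // ¬ π ≠ oneBNC χ}, ∏ V ∈ π.1.1.parts,
      cumulant φ V.card (restrictTo χ V) (restrictTo T V) = cumulant φ n χ T := by
    rw [Fintype.sum_eq_single ⟨oneBNC χ, by simp⟩
      (fun x hx => absurd (Subtype.ext (not_not.mp x.2)) hx)]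
    simp only [hp, Finset.prod_singleton]
    exact cumulant_restrictTo_univ φ n χ T
  rw [← hs, hu, cumulant]
  have : ∀ π : BNC χ, ∏ V : {V : Finset (Fin n) // V ∈ π.1.parts},
      cumulant φ V.1.card (restrictTo χ V.1) (restrictTo T V.1) =
      ∏ V ∈ π.1.parts, cumulant φ V.card (restrictTo χ V) (restrictTo T V) := fun π =>
    Finset.prod_coe_sort π.1.parts
      (fun V => cumulant φ V.card (restrictTo χ V) (restrictTo T V))
  simp only [this]
  ring

end Moments

/-! ### Vector spaces with specified state-vector and their free product -/

universe w

/-- A complex vector space `X` with a specified state-vector: a vector `ξ` and a projection `p`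
onto `ℂ ξ`. The projection is encoded by the functional `ψ` with `p x = ψ(x) ξ`, `ψ(ξ) = 1`. -/
structure PointedSpace where
  carrier : Type w
  [addCommGroup : AddCommGroup carrier]
  [module : Module ℂ carrier]
  vec : carrier
  state : carrier →ₗ[ℂ] ℂ
  state_vec : state vec = 1

attribute [instance] PointedSpace.addCommGroup PointedSpace.module

instance : CoeSort PointedSpace.{w} (Type w) := ⟨PointedSpace.carrier⟩

namespace PointedSpace

/-- The complement `X° = ker p` of `ℂ ξ`. -/
abbrev red (X : PointedSpace.{w}) : Submodule ℂ X := LinearMap.ker X.state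

/-- The projection `1 - p : X → X°`. -/
def toRed (X : PointedSpace.{w}) : X →ₗ[ℂ] X.red :=
  LinearMap.codRestrict X.red (LinearMap.id - X.state.smulRight X.vec)
    (fun x => by simp [X.state_vec])

theorem toRed_apply (X : PointedSpace.{w}) (x : X) : (X.toRed x : X) = x - X.state x • X.vec :=
  rfl

end PointedSpace

section FreeProduct

open TensorAlgebra

variable (X : Bool → PointedSpace.{w})

/-- The tensor algebra of `X'° ⊕ X''°`. As a vector space it is the direct sum of the
`X°_{ε_1} ⊗ ⋯ ⊗ X°_{ε_m}` over all words `ε_1 … ε_m` in the two shades. -/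
abbrev FockAlg : Type w := TensorAlgebra ℂ (∀ ε, (X ε).red)

/-- The inclusion of `X°_ε` as tensors of length one. -/
noncomputable def letter (ε : Bool) : (X ε).red →ₗ[ℂ] FockAlg X :=
  ι ℂ ∘ₗ LinearMap.single ℂ (fun δ => (X δ).red) ε

/-- The free product of the pointed vector spaces: the span of the alternating tensors
`x_1 ⊗ ⋯ ⊗ x_m` (`m ≥ 0`, `x_i ∈ X°_{ε_i}`, `ε_1 ≠ ε_2 ≠ ⋯ ≠ ε_m`), that is
`ℂ ξ ⊕ ⨁ X°_{ε_1} ⊗ ⋯ ⊗ X°_{ε_m}`; the state-vector `ξ` is the empty tensor. -/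
noncomputable def freeProd : Submodule ℂ (FockAlg X) :=
  Submodule.span ℂ {w | ∃ L : List (Σ ε, (X ε).red),
    L.IsChain (fun a b => a.1 ≠ b.1) ∧ w = (L.map fun a => letter X a.1 a.2).prod}

/-- The inclusion of `X_ε = ℂ ξ_ε ⊕ X°_ε` in the free product. -/
noncomputable def incl (ε : Bool) : X ε →ₗ[ℂ] FockAlg X :=
  (Algebra.linearMap ℂ (FockAlg X)) ∘ₗ (X ε).state + letter X ε ∘ₗ (X ε).toRed

variable {E : Type w} [AddCommGroup E] [Module ℂ E]

/-- The pair map `(u, v) ↦ (e u, B(e) u)`, linear in `e`. -/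
noncomputable def firstStep (B : E →ₗ[ℂ] TensorAlgebra ℂ E) :
    E →ₗ[ℂ] Module.End ℂ (TensorAlgebra ℂ E × TensorAlgebra ℂ E) where
  toFun e := (LinearMap.mulLeft ℂ (ι ℂ e) ∘ₗ LinearMap.fst ℂ _ _).prod
    (LinearMap.mulLeft ℂ (B e) ∘ₗ LinearMap.fst ℂ _ _)
  map_add' a b := by ext <;> simp [add_mul]
  map_smul' a b := by ext <;> simp

/-- The pair map `(u, v) ↦ (u e, u B(e))`, linear in `e`. -/
noncomputable def lastStep (B : E →ₗ[ℂ] TensorAlgebra ℂ E) :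
    E →ₗ[ℂ] (Module.End ℂ (TensorAlgebra ℂ E × TensorAlgebra ℂ E))ᵐᵒᵖ where
  toFun e := MulOpposite.op ((LinearMap.mulRight ℂ (ι ℂ e) ∘ₗ LinearMap.fst ℂ _ _).prod
    (LinearMap.mulRight ℂ (B e) ∘ₗ LinearMap.fst ℂ _ _))
  map_add' a b := by
    rw [← MulOpposite.op_add]
    congr 1
    ext <;> simp [mul_add]
  map_smul' a b := by
    rw [RingHom.id_apply, ← MulOpposite.op_smul]
    congr 1
    ext <;> simp

/-- The linear map with `1 ↦ c` and `e ⊗ v ↦ B(e) v` for `e ∈ E`; see `onFirst_one` and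
`onFirst_mul`. -/
noncomputable def onFirst (c : TensorAlgebra ℂ E) (B : E →ₗ[ℂ] TensorAlgebra ℂ E) :
    TensorAlgebra ℂ E →ₗ[ℂ] TensorAlgebra ℂ E :=
  LinearMap.snd ℂ _ _ ∘ₗ LinearMap.applyₗ (1, c) ∘ₗ (lift ℂ (firstStep B)).toLinearMap

/-- The linear map with `1 ↦ c` and `v ⊗ e ↦ v B(e)` for `e ∈ E`; see `onLast_one` and
`onLast_mul`. -/
noncomputable def onLast (c : TensorAlgebra ℂ E) (B : E →ₗ[ℂ] TensorAlgebra ℂ E) :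
    TensorAlgebra ℂ E →ₗ[ℂ] TensorAlgebra ℂ E :=
  LinearMap.snd ℂ _ _ ∘ₗ LinearMap.applyₗ (1, c) ∘ₗ
    (MulOpposite.opLinearEquiv ℂ).symm.toLinearMap ∘ₗ (lift ℂ (lastStep B)).toLinearMap

theorem onFirst_one (c : TensorAlgebra ℂ E) (B : E →ₗ[ℂ] TensorAlgebra ℂ E) :
    onFirst c B 1 = c := by
  simp [onFirst]

theorem onLast_one (c : TensorAlgebra ℂ E) (B : E →ₗ[ℂ] TensorAlgebra ℂ E) :
    onLast c B 1 = c := by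
  simp [onLast]

theorem lift_firstStep_fst (B : E →ₗ[ℂ] TensorAlgebra ℂ E) (v : TensorAlgebra ℂ E)
    (p : TensorAlgebra ℂ E × TensorAlgebra ℂ E) : (lift ℂ (firstStep B) v p).1 = v * p.1 := by
  induction v using TensorAlgebra.induction generalizing p with
  | algebraMap r => simp [Algebra.algebraMap_eq_smul_one]
  | ι x => simp [firstStep]
  | mul a b ha hb => simp [ha, hb, mul_assoc]
  | add a b ha hb => simp [ha, hb, add_mul]

theorem lift_lastStep_fst (B : E →ₗ[ℂ] TensorAlgebra ℂ E) (v : TensorAlgebra ℂ E)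
    (p : TensorAlgebra ℂ E × TensorAlgebra ℂ E) :
    ((lift ℂ (lastStep B) v).unop p).1 = p.1 * v := by
  induction v using TensorAlgebra.induction generalizing p with
  | algebraMap r => simp [Algebra.algebraMap_eq_smul_one]
  | ι x => simp [lastStep]
  | mul a b ha hb => simp [ha, hb, mul_assoc]
  | add a b ha hb => simp [ha, hb, mul_add]

theorem onFirst_mul (c : TensorAlgebra ℂ E) (B : E →ₗ[ℂ] TensorAlgebra ℂ E) (e : E)
    (v : TensorAlgebra ℂ E) : onFirst c B (ι ℂ e * v) = B e * v := by
  have h : onFirst c B (ι ℂ e * v) = B e * (lift ℂ (firstStep B) v (1, c)).1 := by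
    simp only [onFirst, LinearMap.comp_apply, AlgHom.toLinearMap_apply, map_mul, lift_ι_apply,
      LinearMap.applyₗ_apply_apply, Module.End.mul_apply]
    rfl
  rw [h, lift_firstStep_fst, mul_one]

theorem onLast_mul (c : TensorAlgebra ℂ E) (B : E →ₗ[ℂ] TensorAlgebra ℂ E) (e : E)
    (v : TensorAlgebra ℂ E) : onLast c B (v * ι ℂ e) = v * B e := by
  have h : onLast c B (v * ι ℂ e) = ((lift ℂ (lastStep B) v).unop (1, c)).1 * B e := by
    simp only [onLast, LinearMap.comp_apply, AlgHom.toLinearMap_apply, map_mul, lift_ι_apply,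
      LinearMap.applyₗ_apply_apply, LinearEquiv.coe_coe, MulOpposite.coe_opLinearEquiv_symm,
      MulOpposite.unop_mul, Module.End.mul_apply]
    rfl
  rw [h, lift_lastStep_fst, one_mul]

/-- The action of `λ_ε(T)` on the first letter `e = (e', e'')` of a tensor: the component
`e_ε ∈ X°_ε` is replaced by `T e_ε`, and in front of the other component `T ξ_ε` is inserted. -/
noncomputable def leftLetter (ε : Bool) (T : Module.End ℂ (X ε)) :
    (∀ δ, (X δ).red) →ₗ[ℂ] FockAlg X :=
  incl X ε ∘ₗ T ∘ₗ (X ε).red.subtype ∘ₗ LinearMap.proj ε +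
    LinearMap.mulLeft ℂ (incl X ε (T (X ε).vec)) ∘ₗ
      (ι ℂ - letter X ε ∘ₗ LinearMap.proj ε)

/-- The action of `ρ_ε(T)` on the last letter of a tensor. -/
noncomputable def rightLetter (ε : Bool) (T : Module.End ℂ (X ε)) :
    (∀ δ, (X δ).red) →ₗ[ℂ] FockAlg X :=
  incl X ε ∘ₗ T ∘ₗ (X ε).red.subtype ∘ₗ LinearMap.proj ε +
    LinearMap.mulRight ℂ (incl X ε (T (X ε).vec)) ∘ₗ
      (ι ℂ - letter X ε ∘ₗ LinearMap.proj ε)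

/-- The operator `λ_ε(T)`, on all tensors. -/
noncomputable def leftOp (ε : Bool) (T : Module.End ℂ (X ε)) : FockAlg X →ₗ[ℂ] FockAlg X :=
  onFirst (incl X ε (T (X ε).vec)) (leftLetter X ε T)

/-- The operator `ρ_ε(T)`, on all tensors. -/
noncomputable def rightOp (ε : Bool) (T : Module.End ℂ (X ε)) : FockAlg X →ₗ[ℂ] FockAlg X :=
  onLast (incl X ε (T (X ε).vec)) (rightLetter X ε T)

theorem leftLetter_single (ε δ : Bool) (T : Module.End ℂ (X ε)) (x : (X δ).red) :
    leftLetter X ε T (LinearMap.single ℂ (fun δ => (X δ).red) δ x) =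
      if h : δ = ε then incl X ε (T (h ▸ x : (X ε).red))
      else incl X ε (T (X ε).vec) * letter X δ x := by
  split_ifs with h
  · subst h
    simp [leftLetter, letter]
  · simp [leftLetter, letter, Pi.single_eq_of_ne (Ne.symm h)]

theorem rightLetter_single (ε δ : Bool) (T : Module.End ℂ (X ε)) (x : (X δ).red) :
    rightLetter X ε T (LinearMap.single ℂ (fun δ => (X δ).red) δ x) =
      if h : δ = ε then incl X ε (T (h ▸ x : (X ε).red))
      else letter X δ x * incl X ε (T (X ε).vec) := by
  split_ifs with h
  · subst h
    simp [rightLetter, letter]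
  · simp [rightLetter, letter, Pi.single_eq_of_ne (Ne.symm h)]

theorem incl_mul_mem (ε : Bool) (x : X ε) (L : List (Σ ε, (X ε).red))
    (hL : L.IsChain (fun a b => a.1 ≠ b.1)) (h : ∀ a ∈ L.head?, ε ≠ a.1) :
    incl X ε x * (L.map fun a => letter X a.1 a.2).prod ∈ freeProd X := by
  have h1 : (L.map fun a => letter X a.1 a.2).prod ∈ freeProd X :=
    Submodule.subset_span ⟨L, hL, rfl⟩
  have h2 : letter X ε ((X ε).toRed x) * (L.map fun a => letter X a.1 a.2).prod ∈ freeProd X :=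
    Submodule.subset_span ⟨⟨ε, (X ε).toRed x⟩ :: L, List.isChain_cons.mpr ⟨h, hL⟩, by simp⟩
  have : incl X ε x * (L.map fun a => letter X a.1 a.2).prod =
      (X ε).state x • (L.map fun a => letter X a.1 a.2).prod +
        letter X ε ((X ε).toRed x) * (L.map fun a => letter X a.1 a.2).prod := by
    simp [incl, add_mul, Algebra.algebraMap_eq_smul_one]
  rw [this]
  exact add_mem (Submodule.smul_mem _ _ h1) h2

theorem mul_incl_mem (ε : Bool) (x : X ε) (L : List (Σ ε, (X ε).red))
    (hL : L.IsChain (fun a b => a.1 ≠ b.1)) (h : ∀ a ∈ L.getLast?, a.1 ≠ ε) :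
    (L.map fun a => letter X a.1 a.2).prod * incl X ε x ∈ freeProd X := by
  have h1 : (L.map fun a => letter X a.1 a.2).prod ∈ freeProd X :=
    Submodule.subset_span ⟨L, hL, rfl⟩
  have h2 : (L.map fun a => letter X a.1 a.2).prod * letter X ε ((X ε).toRed x) ∈ freeProd X :=
    Submodule.subset_span ⟨L ++ [⟨ε, (X ε).toRed x⟩],
      List.isChain_append.mpr ⟨hL, List.isChain_singleton _, by simpa using h⟩, by simp⟩
  have : (L.map fun a => letter X a.1 a.2).prod * incl X ε x =
      (X ε).state x • (L.map fun a => letter X a.1 a.2).prod +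
        (L.map fun a => letter X a.1 a.2).prod * letter X ε ((X ε).toRed x) := by
    simp [incl, mul_add, Algebra.algebraMap_eq_smul_one]
  rw [this]
  exact add_mem (Submodule.smul_mem _ _ h1) h2

theorem leftOp_mem (ε : Bool) (T : Module.End ℂ (X ε)) :
    ∀ v ∈ freeProd X, leftOp X ε T v ∈ freeProd X := by
  intro v hv
  induction hv using Submodule.span_induction with
  | zero => simp
  | add a b _ _ ha hb => rw [map_add]; exact add_mem ha hb
  | smul c a _ ha => rw [map_smul]; exact Submodule.smul_mem _ _ ha
  | mem a ha =>
    obtain ⟨L, hL, rfl⟩ := ha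
    cases L with
    | nil =>
      have := incl_mul_mem X ε (T (X ε).vec) [] List.isChain_nil (by simp)
      simpa [leftOp, onFirst_one] using this
    | cons a L =>
      obtain ⟨δ, x⟩ := a
      have hL' := List.isChain_cons.mp hL
      have h1 : leftOp X ε T ((⟨δ, x⟩ :: L : List (Σ ε, (X ε).red)).map
          fun a => letter X a.1 a.2).prod =
          leftLetter X ε T (LinearMap.single ℂ (fun δ => (X δ).red) δ x) *
            (L.map fun a => letter X a.1 a.2).prod := by
        rw [List.map_cons, List.prod_cons]
        exact onFirst_mul _ _ _ _
      rw [h1, leftLetter_single]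
      split_ifs with h
      · subst h
        exact incl_mul_mem X _ _ L hL'.2 hL'.1
      · have := incl_mul_mem X ε (T (X ε).vec) (⟨δ, x⟩ :: L) hL
          (by simpa using Ne.symm h)
        simpa [mul_assoc] using this

theorem rightOp_mem (ε : Bool) (T : Module.End ℂ (X ε)) :
    ∀ v ∈ freeProd X, rightOp X ε T v ∈ freeProd X := by
  intro v hv
  induction hv using Submodule.span_induction with
  | zero => simp
  | add a b _ _ ha hb => rw [map_add]; exact add_mem ha hb
  | smul c a _ ha => rw [map_smul]; exact Submodule.smul_mem _ _ ha
  | mem a ha =>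
    obtain ⟨L, hL, rfl⟩ := ha
    rcases List.eq_nil_or_concat' L with rfl | ⟨L, ⟨δ, x⟩, rfl⟩
    · have := mul_incl_mem X ε (T (X ε).vec) [] List.isChain_nil (by simp)
      simpa [rightOp, onLast_one] using this
    · have hL' := List.isChain_append.mp hL
      have h1 : rightOp X ε T ((L ++ [⟨δ, x⟩] : List (Σ ε, (X ε).red)).map
          fun a => letter X a.1 a.2).prod =
          (L.map fun a => letter X a.1 a.2).prod *
            rightLetter X ε T (LinearMap.single ℂ (fun δ => (X δ).red) δ x) := by
        rw [List.map_append, List.prod_append, List.map_singleton, List.prod_singleton]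
        exact onLast_mul _ _ _ _
      rw [h1, rightLetter_single]
      split_ifs with h
      · subst h
        exact mul_incl_mem X _ _ L hL'.1 (by simpa using hL'.2.2)
      · have := mul_incl_mem X ε (T (X ε).vec) (L ++ [⟨δ, x⟩]) hL
          (by simpa using h)
        simpa [mul_assoc] using this

/-- The left representation `λ_ε` of the operators on `X_ε` on the free product. It is
characterized by `λ_ε(T)(x ⊗ v) = T x ⊗ v` for `x ∈ X_ε` and tensors `v` whose first letter is not
in `X°_ε`, where `X_ε = ℂ ξ ⊕ X°_ε` and `ξ ⊗ v = v`. -/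
noncomputable def leftRep (ε : Bool) (T : Module.End ℂ (X ε)) : Module.End ℂ (freeProd X) :=
  (leftOp X ε T).restrict (leftOp_mem X ε T)

/-- The right representation `ρ_ε` of the operators on `X_ε` on the free product:
`ρ_ε(T)(v ⊗ x) = v ⊗ T x` for `x ∈ X_ε` and tensors `v` whose last letter is not in `X°_ε`. -/
noncomputable def rightRep (ε : Bool) (T : Module.End ℂ (X ε)) : Module.End ℂ (freeProd X) :=
  (rightOp X ε T).restrict (rightOp_mem X ε T)

/-- The state-vector `ξ` of the free product. -/
noncomputable def vacuum : freeProd X :=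
  ⟨1, Submodule.subset_span ⟨[], List.isChain_nil, by simp⟩⟩

/-- The state `S ↦ ψ(S ξ)` on the operators on the free product, where `ψ` is the coefficient of
`ξ` (it vanishes on tensors of positive length). -/
noncomputable def vacuumState (S : Module.End ℂ (freeProd X)) : ℂ :=
  TensorAlgebra.algebraMapInv (S (vacuum X) : FockAlg X)

end FreeProduct

/-! ### Bi-free two-faced families -/

/-- Bi-freeness of two two-faced families `z', z''` in `(A, φ)`, the left face being indexed by `I`
and the right face by `J`; the shades `'` and `''` are `false` and `true`. -/
def BiFree {I J : Type*} {A : Type w} [Ring A] [Algebra ℂ A] (φ : A →ₗ[ℂ] ℂ)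
    (z' z'' : I ⊕ J → A) : Prop :=
  ∃ (X : Bool → PointedSpace.{w})
    (l : ∀ ε, FreeAlgebra ℂ I →ₐ[ℂ] Module.End ℂ (X ε))
    (r : ∀ ε, FreeAlgebra ℂ J →ₐ[ℂ] Module.End ℂ (X ε)),
    ∀ word : List (Bool × (I ⊕ J)),
      φ (word.map fun q => (bif q.1 then z'' else z') q.2).prod =
        vacuumState X (word.map fun q =>
          Sum.elim (fun i => leftRep X q.1 (l q.1 (FreeAlgebra.ι ℂ i)))
            (fun j => rightRep X q.1 (r q.1 (FreeAlgebra.ι ℂ j))) q.2).prod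

/-! ### The polynomials `R_α` -/

/-- The index set of the indeterminates `X_K`: the non-empty subsets `K` of `{1, …, n}`. -/
abbrev NonemptySubset (n : ℕ) : Type := {K : Finset (Fin n) // K.Nonempty}

/-- `R_α = ∑_{π ∈ BNC(α)} μ_BNC(π, 1_α) ∏_{V ∈ π} X_V`. -/
noncomputable def RPoly {I J : Type*} {n : ℕ} (α : Fin n → I ⊕ J) :
    MvPolynomial (NonemptySubset n) ℂ :=
  ∑ π : BNC (faceOf ∘ α), MvPolynomial.C (muBNC (faceOf ∘ α) π (oneBNC (faceOf ∘ α))) *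
    ∏ V : {V : Finset (Fin n) // V ∈ π.1.parts},
      MvPolynomial.X ⟨V.1, π.1.nonempty_of_mem_parts V.2⟩

/-- The degree `|K|` of the indeterminate `X_K`. -/
def cardWeight (n : ℕ) : NonemptySubset n → ℕ := fun K => K.1.card

/-- The value of a polynomial at the point
`X_{{k_1 < ⋯ < k_r}} = φ(z_{α(k_1)} ⋯ z_{α(k_r)})`. -/
noncomputable def evalMoments {I J A : Type*} [Ring A] [Algebra ℂ A] {n : ℕ}
    (α : Fin n → I ⊕ J) (φ : A →ₗ[ℂ] ℂ) (z : I ⊕ J → A)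
    (P : MvPolynomial (NonemptySubset n) ℂ) : ℂ :=
  MvPolynomial.eval (fun K => moment φ (restrictTo (z ∘ α) K.1)) P

/-- The cumulant property of a polynomial: it is additive on bi-free pairs. -/
def HasCumulantProperty {I J : Type*} {n : ℕ} (α : Fin n → I ⊕ J)
    (P : MvPolynomial (NonemptySubset n) ℂ) : Prop :=
  ∀ (A : Type w) [Ring A] [Algebra ℂ A] (φ : A →ₗ[ℂ] ℂ), φ 1 = 1 →
    ∀ z' z'' : I ⊕ J → A, BiFree φ z' z'' →
      evalMoments α φ (z' + z'') P = evalMoments α φ z' P + evalMoments α φ z'' P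

/-- `P` is a universal bi-free cumulant polynomial for `α`: it is homogeneous of degree `n`, of
the form `X_{{1, …, n}} + Q` with `Q` a polynomial, homogeneous of degree `n`, in the `X_K` with
`K ≠ {1, …, n}`, and it has the cumulant property. -/
structure IsUniversalCumulantPolynomial {I J : Type*} {n : ℕ} [NeZero n] (α : Fin n → I ⊕ J)
    (P : MvPolynomial (NonemptySubset n) ℂ) : Prop where
  leading : ∃ Q ∈ MvPolynomial.supported ℂ {K : NonemptySubset n | K.1 ≠ univ},
    P = MvPolynomial.X ⟨univ, univ_nonempty⟩ + Q ∧ Q.IsWeightedHomogeneous (cardWeight n) n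
  homogeneous : P.IsWeightedHomogeneous (cardWeight n) n
  cumulant_property : HasCumulantProperty.{w} α P

/-! Bi-non-crossing partitions are the non-crossing partitions for the order of the nodes given by
`nodeKey`, so every sum over `BNC χ` is a sum `ncSum` over non-crossing partitions of a finite set.
The sum over the non-crossing refinements of a non-crossing partition factorizes over its blocks
(`sum_ncPartitions_refine`), and Möbius inversion on `BNC χ` then identifies the value of `RPoly α`
at the moments with the cumulant (`cumulant_eq_sum_muBNC`).

Additivity amounts to the vanishing of mixed cumulants. Cut a set of nodes, ordered by `nodeKey`,
into maximal one-coloured intervals, its runs. In the free product the alternating sum that centres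
every run, applied to the state-vector, is a pure tensor with one reduced letter per run
(`centered_wordVec`), so its vacuum coefficient is zero. The reason is that the operator applied
last is either a left one belonging to the first run or a right one belonging to the last run, and
hence acts on an end letter. The same alternating sums vanish for the `ncSum` of a function that is
zero on blocks with two colours: by inclusion-exclusion they count the partitions in which no run is
a union of blocks, and a non-crossing partition into one-coloured blocks always has such a run
(`exists_isClosedIn`). Since these vanishing conditions determine all values from the one at the
empty set, both functions agree (`blockMoment_eq_ncSum_mixedCumulant`). Expanding the moments of `z'
+ z''` over colourings, and inducting on `n`, gives `cumulant_add`.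

For uniqueness, let `D` be the difference of two universal polynomials; it does not involve the
indeterminate of the full set. The sum of two bi-free copies of a family has doubled cumulants, and
the value of `D` is doubled too. Iterating, scaling all cumulants by `t = 2 ^ k` scales the value of
`D` by `t`. As a function of `t` this value is a polynomial divisible by `t ^ 2`, because moments
are divisible by `t` and `D` has no linear monomial; so it is zero. For injective `α` the moments
are arbitrary numbers, and vanishing on all moments becomes equality of polynomials. -/

/-! ### Sums over non-crossing partitions and their factorization -/

section NonCrossingSums

open scoped Classical in
section

variable {ι : Type*}

/-- The blocks `V` and `W` do not cross with respect to the order given by `key`. -/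
def NonCross (key : ι → ℤ) (V W : Finset ι) : Prop :=
  ∀ a ∈ V, ∀ b ∈ W, ∀ c ∈ V, ∀ d ∈ W, ¬ (key a < key b ∧ key b < key c ∧ key c < key d)

theorem NonCross.mono {key : ι → ℤ} {V W V' W' : Finset ι} (h : NonCross key V W)
    (hV : V' ⊆ V) (hW : W' ⊆ W) : NonCross key V' W' :=
  fun a ha b hb c hc d hd => h a (hV ha) b (hW hb) c (hV hc) d (hW hd)

/-- `S` is the set of blocks of a non-crossing partition of `V`. -/
structure IsNCPartition (key : ι → ℤ) (V : Finset ι) (S : Finset (Finset ι)) : Prop where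
  subset : ∀ W ∈ S, W ⊆ V
  cover : ∀ a ∈ V, ∃ W ∈ S, a ∈ W
  nonempty : ∀ W ∈ S, W.Nonempty
  eq_of_mem : ∀ W ∈ S, ∀ W' ∈ S, ∀ a ∈ W, a ∈ W' → W = W'
  nonCross : ∀ W ∈ S, ∀ W' ∈ S, W ≠ W' → NonCross key W W'

/-- The set of all non-crossing partitions of `V`. -/
noncomputable def ncPartitions (key : ι → ℤ) (V : Finset ι) : Finset (Finset (Finset ι)) :=
  V.powerset.powerset.filter (IsNCPartition key V)

theorem mem_ncPartitions {key : ι → ℤ} {V : Finset ι} {S : Finset (Finset ι)} :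
    S ∈ ncPartitions key V ↔ IsNCPartition key V S := by
  rw [ncPartitions, mem_filter, and_iff_right_iff_imp]
  exact fun h => mem_powerset.2 fun W hW => mem_powerset.2 (h.subset W hW)

/-- The sum of `∏ κ(W)` over all non-crossing partitions of `V`. -/
noncomputable def ncSum (key : ι → ℤ) (κ : Finset ι → ℂ) (V : Finset ι) : ℂ :=
  ∑ S ∈ ncPartitions key V, ∏ W ∈ S, κ W

theorem ncPartitions_empty (key : ι → ℤ) : ncPartitions key ∅ = {∅} := by
  ext S
  rw [mem_ncPartitions, mem_singleton]
  constructor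
  · intro h
    refine eq_empty_of_forall_notMem fun W hW => ?_
    obtain ⟨a, ha⟩ := h.nonempty W hW
    exact absurd (h.subset W hW ha) (notMem_empty a)
  · rintro rfl
    constructor <;> simp

theorem ncSum_empty (key : ι → ℤ) (κ : Finset ι → ℂ) : ncSum key κ ∅ = 1 := by
  simp [ncSum, ncPartitions_empty]

theorem ncSum_congr {key : ι → ℤ} {κ κ' : Finset ι → ℂ} {V : Finset ι}
    (h : ∀ W ⊆ V, W.Nonempty → κ W = κ' W) : ncSum key κ V = ncSum key κ' V := by
  refine sum_congr rfl fun S hS => prod_congr rfl fun W hW => ?_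
  rw [mem_ncPartitions] at hS
  exact h W (hS.subset W hW) (hS.nonempty W hW)

variable [DecidableEq ι]

/-- The blocks of `S` lie in `P`, so it is enough that the blocks of `T` do not cross `P` as a
whole; neither `P` nor `Q` need be an interval. -/
theorem IsNCPartition.union {key : ι → ℤ} {P Q : Finset ι} {S T : Finset (Finset ι)}
    (hPQ : Disjoint P Q) (hS : IsNCPartition key P S) (hT : IsNCPartition key Q T)
    (hc : ∀ W ∈ T, NonCross key P W ∧ NonCross key W P) : IsNCPartition key (P ∪ Q) (S ∪ T) where
  subset W hW := by
    rcases mem_union.1 hW with h | h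
    · exact (hS.subset W h).trans subset_union_left
    · exact (hT.subset W h).trans subset_union_right
  cover a ha := by
    rcases mem_union.1 ha with h | h
    · obtain ⟨W, hW, haW⟩ := hS.cover a h
      exact ⟨W, mem_union_left _ hW, haW⟩
    · obtain ⟨W, hW, haW⟩ := hT.cover a h
      exact ⟨W, mem_union_right _ hW, haW⟩
  nonempty W hW := by
    rcases mem_union.1 hW with h | h
    · exact hS.nonempty W h
    · exact hT.nonempty W h
  eq_of_mem W hW W' hW' a ha ha' := by
    rcases mem_union.1 hW with h | h <;> rcases mem_union.1 hW' with h' | h'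
    · exact hS.eq_of_mem W h W' h' a ha ha'
    · exact absurd (hT.subset W' h' ha') (disjoint_left.1 hPQ (hS.subset W h ha))
    · exact absurd (hT.subset W h ha) (disjoint_left.1 hPQ (hS.subset W' h' ha'))
    · exact hT.eq_of_mem W h W' h' a ha ha'
  nonCross W hW W' hW' hne := by
    rcases mem_union.1 hW with h | h <;> rcases mem_union.1 hW' with h' | h'
    · exact hS.nonCross W h W' h' hne
    · exact (hc W' h').1.mono (hS.subset W h) subset_rfl
    · exact (hc W h).2.mono subset_rfl (hS.subset W' h')
    · exact hT.nonCross W h W' h' hne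

theorem IsNCPartition.filter_subset {key : ι → ℤ} {V P : Finset ι} {S : Finset (Finset ι)}
    (hS : IsNCPartition key V S) (hPV : P ⊆ V) (h : ∀ W ∈ S, W ⊆ P ∨ Disjoint W P) :
    IsNCPartition key P (S.filter (· ⊆ P)) where
  subset W hW := (mem_filter.1 hW).2
  cover a ha := by
    obtain ⟨W, hW, haW⟩ := hS.cover a (hPV ha)
    refine ⟨W, mem_filter.2 ⟨hW, (h W hW).resolve_right fun hd => ?_⟩, haW⟩
    exact disjoint_left.1 hd haW ha
  nonempty W hW := hS.nonempty W (mem_filter.1 hW).1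
  eq_of_mem W hW W' hW' := hS.eq_of_mem W (mem_filter.1 hW).1 W' (mem_filter.1 hW').1
  nonCross W hW W' hW' := hS.nonCross W (mem_filter.1 hW).1 W' (mem_filter.1 hW').1

theorem filter_subset_union_left {key : ι → ℤ} {P Q : Finset ι} {S T : Finset (Finset ι)}
    (hPQ : Disjoint P Q) (hS : IsNCPartition key P S) (hT : IsNCPartition key Q T) :
    (S ∪ T).filter (· ⊆ P) = S := by
  ext W
  simp only [mem_filter, mem_union]
  constructor
  · rintro ⟨h | h, hP⟩
    · exact h
    · obtain ⟨a, ha⟩ := hT.nonempty W h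
      exact absurd (hT.subset W h ha) (disjoint_left.1 hPQ (hP ha))
  · exact fun h => ⟨Or.inl h, hS.subset W h⟩

/-- The non-crossing partitions of `P ∪ Q` that refine `{P, Q}` (and whose part on `Q` has a
property that prevents crossings with `P`) are the pairs of partitions of `P` and of `Q`. -/
theorem sum_ncPartitions_union {key : ι → ℤ} {P Q : Finset ι} (hPQ : Disjoint P Q)
    (p : Finset (Finset ι) → Prop) [DecidablePred p]
    (hp : ∀ S ∈ ncPartitions key Q, p S → ∀ W ∈ S, NonCross key P W ∧ NonCross key W P)
    (κ : Finset ι → ℂ) :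
    ∑ S ∈ ncPartitions key (P ∪ Q) with (∀ W ∈ S, W ⊆ P ∨ W ⊆ Q) ∧ p (S.filter (· ⊆ Q)),
      ∏ W ∈ S, κ W =
    ncSum key κ P * ∑ S ∈ ncPartitions key Q with p S, ∏ W ∈ S, κ W := by
  rw [ncSum, sum_mul_sum, ← sum_product']
  symm
  have hdis : ∀ S T, IsNCPartition key P S → IsNCPartition key Q T → Disjoint S T := by
    intro S T hS hT
    rw [disjoint_left]
    intro W h h'
    obtain ⟨a, ha⟩ := hS.nonempty W h
    exact disjoint_left.1 hPQ (hS.subset W h ha) (hT.subset W h' ha)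
  have hdP : ∀ W, W ⊆ P ∨ W ⊆ Q → W ⊆ P ∨ Disjoint W P := fun W h =>
    h.imp_right fun h => hPQ.symm.mono_left h
  have hdQ : ∀ W, W ⊆ P ∨ W ⊆ Q → W ⊆ Q ∨ Disjoint W Q := fun W h =>
    h.symm.imp_right fun h => hPQ.mono_left h
  refine sum_nbij' (fun x => x.1 ∪ x.2) (fun S => (S.filter (· ⊆ P), S.filter (· ⊆ Q))) ?_ ?_ ?_ ?_ ?_
  · rintro ⟨S, T⟩ h
    simp only [mem_product, mem_filter, mem_ncPartitions] at h ⊢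
    obtain ⟨hS, hT, hpT⟩ := h
    refine ⟨hS.union hPQ hT (hp T (mem_ncPartitions.2 hT) hpT), fun W hW => ?_, ?_⟩
    · exact (mem_union.1 hW).imp (hS.subset W) (hT.subset W)
    · rwa [union_comm, filter_subset_union_left hPQ.symm hT hS]
  · intro S h
    simp only [mem_product, mem_filter, mem_ncPartitions] at h ⊢
    obtain ⟨hS, h1, h2⟩ := h
    exact ⟨hS.filter_subset subset_union_left fun W hW => hdP W (h1 W hW),
      hS.filter_subset subset_union_right fun W hW => hdQ W (h1 W hW), h2⟩
  · rintro ⟨S, T⟩ h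
    simp only [mem_product, mem_filter, mem_ncPartitions] at h
    simp only [Prod.mk.injEq]
    refine ⟨filter_subset_union_left hPQ h.1 h.2.1, ?_⟩
    rw [union_comm, filter_subset_union_left hPQ.symm h.2.1 h.1]
  · intro S h
    simp only [mem_filter, mem_ncPartitions] at h
    rw [← filter_or, filter_true_of_mem h.2.1]
  · rintro ⟨S, T⟩ h
    simp only [mem_product, mem_filter, mem_ncPartitions] at h
    exact (prod_union (hdis S T h.1 h.2.1)).symm

/-- The sum over the non-crossing refinements of a non-crossing partition factorizes. -/
theorem sum_ncPartitions_refine (key : ι → ℤ) (κ : Finset ι → ℂ) (π : Finset (Finset ι)) :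
    ∀ V, IsNCPartition key V π →
      ∑ S ∈ ncPartitions key V with ∀ W ∈ S, ∃ P ∈ π, W ⊆ P, ∏ W ∈ S, κ W =
        ∏ P ∈ π, ncSum key κ P := by
  induction π using Finset.induction_on with
  | empty =>
    intro V h
    have hV : V = ∅ := eq_empty_of_forall_notMem fun a ha => by
      obtain ⟨W, hW, -⟩ := h.cover a ha
      exact absurd hW (notMem_empty W)
    subst hV
    rw [ncPartitions_empty, filter_true_of_mem (by simp)]
    simp
  | insert P π hP ih =>
    intro V h
    obtain ⟨Q, hQ⟩ : ∃ Q, Q = V \ P := ⟨_, rfl⟩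
    have hPV : P ⊆ V := h.subset P (mem_insert_self P π)
    have hV : V = P ∪ Q := by rw [hQ, union_sdiff_of_subset hPV]
    have hPQ : Disjoint P Q := hQ ▸ disjoint_sdiff
    have hsub : ∀ W ∈ π, W ⊆ Q := by
      intro W hW a ha
      have haV := h.subset W (mem_insert_of_mem hW) ha
      rw [hQ, mem_sdiff]
      refine ⟨haV, fun haP => hP ?_⟩
      rwa [h.eq_of_mem P (mem_insert_self P π) W (mem_insert_of_mem hW) a haP ha]
    have hπ : IsNCPartition key Q π :=
      { subset := hsub
        cover := fun a ha => by
          rw [hQ, mem_sdiff] at ha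
          obtain ⟨W, hW, haW⟩ := h.cover a ha.1
          rcases mem_insert.1 hW with rfl | hW
          · exact absurd haW ha.2
          · exact ⟨W, hW, haW⟩
        nonempty := fun W hW => h.nonempty W (mem_insert_of_mem hW)
        eq_of_mem := fun W hW W' hW' =>
          h.eq_of_mem W (mem_insert_of_mem hW) W' (mem_insert_of_mem hW')
        nonCross := fun W hW W' hW' =>
          h.nonCross W (mem_insert_of_mem hW) W' (mem_insert_of_mem hW') }
    -- A block inside some `P' ∈ π` cannot cross `P`, since `P'` does not. So refining the rest of
    -- `π` is a property of the kind that the splitting lemma asks for.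
    have hsplit := sum_ncPartitions_union (key := key) hPQ (fun S => ∀ W ∈ S, ∃ P ∈ π, W ⊆ P) ?_ κ
    · rw [prod_insert hP, ← ih Q hπ, hV]
      refine Eq.trans (sum_congr (Finset.ext fun S => ?_) fun _ _ => rfl) (hsplit.trans
        (congrArg _ (sum_congr (Finset.ext fun S => by simp only [mem_filter]) fun _ _ => rfl)))
      simp only [mem_filter (s := ncPartitions key (P ∪ Q))]
      refine and_congr_right fun hS => ?_
      rw [mem_ncPartitions] at hS
      constructor
      · intro hr
        refine ⟨fun W hW => ?_, fun W hW => ?_⟩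
        · obtain ⟨P', hP', hWP⟩ := hr W hW
          rcases mem_insert.1 hP' with rfl | hP'
          · exact Or.inl hWP
          · exact Or.inr (hWP.trans (hsub P' hP'))
        · rw [mem_filter] at hW
          obtain ⟨P', hP', hWP⟩ := hr W hW.1
          rcases mem_insert.1 hP' with rfl | hP'
          · obtain ⟨a, ha⟩ := hS.nonempty W hW.1
            exact absurd (hW.2 ha) (disjoint_left.1 hPQ (hWP ha))
          · exact ⟨P', hP', hWP⟩
      · rintro ⟨h1, h2⟩ W hW
        rcases h1 W hW with hWP | hWQ
        · exact ⟨P, mem_insert_self P π, hWP⟩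
        · obtain ⟨P', hP', hWP⟩ := h2 W (mem_filter.2 ⟨hW, hWQ⟩)
          exact ⟨P', mem_insert_of_mem hP', hWP⟩
    · intro S _ hr W hW
      obtain ⟨P', hP', hWP⟩ := hr W hW
      have hne : P ≠ P' := fun he => hP (he ▸ hP')
      exact ⟨(h.nonCross P (mem_insert_self P π) P' (mem_insert_of_mem hP') hne).mono
          subset_rfl hWP,
        (h.nonCross P' (mem_insert_of_mem hP') P (mem_insert_self P π) hne.symm).mono
          hWP subset_rfl⟩

end

end NonCrossingSums

/-! ### Runs of one colour and centred alternating sums -/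

section Runs

open scoped Classical in
section

variable {ι : Type*}

/-- A list of runs: consecutive intervals, each of one colour, adjacent ones of different
colours. -/
structure IsRuns (key : ι → ℤ) (ε : ι → Bool) (Rs : List (Bool × Finset ι)) : Prop where
  lt : Rs.Pairwise fun p q => ∀ a ∈ p.2, ∀ b ∈ q.2, key a < key b
  nonempty : ∀ p ∈ Rs, p.2.Nonempty
  color : ∀ p ∈ Rs, ∀ a ∈ p.2, ε a = p.1
  chain : Rs.IsChain fun p q => p.1 ≠ q.1

theorem IsRuns.tail {key : ι → ℤ} {ε : ι → Bool} {p : Bool × Finset ι}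
    {Rs : List (Bool × Finset ι)} (h : IsRuns key ε (p :: Rs)) : IsRuns key ε Rs where
  lt := (List.pairwise_cons.1 h.lt).2
  nonempty q hq := h.nonempty q (List.mem_cons_of_mem _ hq)
  color q hq := h.color q (List.mem_cons_of_mem _ hq)
  chain := h.chain.tail

variable [DecidableEq ι]

/-- The union of the sets in a list of coloured sets. -/
def nodes (Rs : List (Bool × Finset ι)) : Finset ι :=
  Rs.foldr (fun p s => p.2 ∪ s) ∅

@[simp] theorem nodes_nil : nodes ([] : List (Bool × Finset ι)) = ∅ := rfl

@[simp] theorem nodes_cons (p : Bool × Finset ι) (Rs : List (Bool × Finset ι)) :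
    nodes (p :: Rs) = p.2 ∪ nodes Rs := rfl

theorem mem_nodes {Rs : List (Bool × Finset ι)} {a : ι} :
    a ∈ nodes Rs ↔ ∃ p ∈ Rs, a ∈ p.2 := by
  induction Rs with
  | nil => simp
  | cons p Rs ih => simp [ih]

theorem nodes_append (Rs Rs' : List (Bool × Finset ι)) :
    nodes (Rs ++ Rs') = nodes Rs ∪ nodes Rs' := by
  ext a
  simp only [mem_nodes, mem_union, List.mem_append]
  grind

/-- Every finite set decomposes into runs. -/
theorem exists_isRuns {key : ι → ℤ} (hkey : Function.Injective key) (ε : ι → Bool)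
    (V : Finset ι) : ∃ Rs, IsRuns key ε Rs ∧ nodes Rs = V := by
  induction V using Finset.induction_on_min_value key with
  | empty => exact ⟨[], ⟨by simp, by simp, by simp, by simp⟩, rfl⟩
  | insert a V ha hmin ih =>
    obtain ⟨Rs, hR, rfl⟩ := ih
    have hlt : ∀ x ∈ nodes Rs, key a < key x := fun x hx =>
      lt_of_le_of_ne (hmin x hx) fun h => ha (hkey h ▸ hx)
    cases Rs with
    | nil => exact ⟨[(ε a, {a})], ⟨by simp, by simp, by simp, by simp⟩, by simp⟩
    | cons p Rs =>
      by_cases hp : ε a = p.1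
      · refine ⟨(p.1, insert a p.2) :: Rs, ⟨?_, ?_, ?_, ?_⟩, by simp⟩
        · have h := List.pairwise_cons.1 hR.lt
          refine List.pairwise_cons.2 ⟨fun q hq x hx b hb => ?_, h.2⟩
          rcases mem_insert.1 hx with rfl | hx
          · exact hlt b (mem_nodes.2 ⟨q, List.mem_cons_of_mem _ hq, hb⟩)
          · exact h.1 q hq x hx b hb
        · intro q hq
          rcases List.mem_cons.1 hq with rfl | hq
          · exact insert_nonempty _ _
          · exact hR.tail.nonempty q hq
        · intro q hq x hx
          rcases List.mem_cons.1 hq with rfl | hq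
          · rcases mem_insert.1 hx with rfl | hx
            · exact hp
            · exact hR.color p List.mem_cons_self x hx
          · exact hR.tail.color q hq x hx
        · have h := List.isChain_cons.1 hR.chain
          exact List.isChain_cons.2 h
      · refine ⟨(ε a, {a}) :: p :: Rs, ⟨?_, ?_, ?_, ?_⟩, by
          rw [nodes_cons, singleton_union]⟩
        · refine List.pairwise_cons.2 ⟨fun q hq x hx b hb => ?_, hR.lt⟩
          rw [mem_singleton.1 hx]
          exact hlt b (mem_nodes.2 ⟨q, hq, hb⟩)
        · intro q hq
          rcases List.mem_cons.1 hq with rfl | hq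
          · exact singleton_nonempty _
          · exact hR.nonempty q hq
        · intro q hq x hx
          rcases List.mem_cons.1 hq with rfl | hq
          · rw [mem_singleton.1 hx]
          · exact hR.color q hq x hx
        · exact List.isChain_cons_cons.2 ⟨hp, hR.chain⟩

/-- `P` is a union of blocks of `S`. -/
def IsClosedIn (S : Finset (Finset ι)) (P : Finset ι) : Prop :=
  ∀ W ∈ S, W ⊆ P ∨ Disjoint W P

/-- A non-crossing partition with blocks of one colour contains one of the runs as a union of
blocks. -/
theorem exists_isClosedIn {key : ι → ℤ} {ε : ι → Bool} {Rs : List (Bool × Finset ι)}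
    (hR : IsRuns key ε Rs) (hne : Rs ≠ []) {S : Finset (Finset ι)}
    (hS : IsNCPartition key (nodes Rs) S) (hmono : ∀ W ∈ S, ∀ a ∈ W, ∀ b ∈ W, ε a = ε b) :
    ∃ p ∈ Rs, IsClosedIn S p.2 := by
  by_contra! hcon
  -- Assume that no run is a union of blocks: each run then meets a block that also leaves it.
  have hopen : ∀ (m : ℕ) (hm : m < Rs.length), ∃ W ∈ S, ∃ b ∈ W, b ∈ Rs[m].2 ∧
      ∃ d ∈ W, d ∉ Rs[m].2 := by
    intro m hm
    have h := hcon Rs[m] (List.getElem_mem hm)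
    simp only [IsClosedIn, not_forall, not_or, not_disjoint_iff, not_subset] at h
    obtain ⟨W, hW, ⟨d, hd, hd'⟩, b, hb, hb'⟩ := h
    exact ⟨W, hW, b, hb, hb', d, hd, hd'⟩
  have hidx : ∀ a ∈ nodes Rs, ∃ (m : ℕ) (hm : m < Rs.length), a ∈ Rs[m].2 := by
    intro a ha
    obtain ⟨p, hp, hap⟩ := mem_nodes.1 ha
    obtain ⟨m, hm, rfl⟩ := List.getElem_of_mem hp
    exact ⟨m, hm, hap⟩
  have hlt := List.pairwise_iff_getElem.1 hR.lt
  -- No block meets two different runs, by induction on their distance. The two runs have the same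
  -- colour, so they are not adjacent and run `i + 1` lies strictly between them. A block leaving
  -- that run either is `W` itself or, not crossing `W`, stays within the runs `i, …, j`; both cases
  -- give a block meeting two runs at a smaller distance.
  have main : ∀ (k i j : ℕ) (hi : i < Rs.length) (hj : j < Rs.length), i < j → j - i = k →
      ∀ W ∈ S, ∀ a ∈ W, ∀ c ∈ W, a ∈ Rs[i].2 → c ∈ Rs[j].2 → False := by
    intro k
    induction k using Nat.strong_induction_on with
    | _ k ih =>
      intro i j hi hj hij hk W hW a ha c hc hai hcj
      have hcol : Rs[i].1 = Rs[j].1 := by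
        rw [← hR.color _ (List.getElem_mem hi) a hai, ← hR.color _ (List.getElem_mem hj) c hcj]
        exact hmono W hW a ha c hc
      have hm : i + 1 < Rs.length := by omega
      have hchain := List.isChain_iff_getElem.1 hR.chain i hm
      have hmj : i + 1 < j := by
        rcases Nat.lt_or_ge (i + 1) j with h | h
        · exact h
        · obtain rfl : j = i + 1 := by omega
          exact absurd hcol hchain
      obtain ⟨W', hW', b, hb, hbm, d, hd, hdm⟩ := hopen (i + 1) hm
      have hab := hlt i (i + 1) hi hm (Nat.lt_succ_self i) a hai b hbm
      have hbc := hlt (i + 1) j hm hj hmj b hbm c hcj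
      by_cases hWW : W = W'
      · subst hWW
        exact ih (j - (i + 1)) (by omega) (i + 1) j hm hj hmj rfl W hW b hb c hc hbm hcj
      · have hc1 := hS.nonCross W hW W' hW' hWW a ha b hb c hc d hd
        have hc2 := hS.nonCross W' hW' W hW (Ne.symm hWW) d hd a ha b hb c hc
        obtain ⟨m', hm', hdm'⟩ := hidx d (hS.subset W' hW' hd)
        have hne' : m' ≠ i + 1 := by
          rintro rfl
          exact hdm hdm'
        have h1 : i ≤ m' := by
          by_contra! h
          exact hc2 ⟨hlt m' i hm' hi h d hdm' a hai, hab, hbc⟩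
        have h2 : m' ≤ j := by
          by_contra! h
          exact hc1 ⟨hab, hbc, hlt j m' hj hm' h c hcj d hdm'⟩
        rcases Nat.lt_or_ge m' (i + 1) with h | h
        · exact ih (i + 1 - m') (by omega) m' (i + 1) hm' hm h rfl W' hW' d hd b hb hdm' hbm
        · exact ih (m' - (i + 1)) (by omega) (i + 1) m' hm hm' (by omega) rfl W' hW' b hb d hd
            hbm hdm'
  have h0 : 0 < Rs.length := List.length_pos_of_ne_nil hne
  obtain ⟨W, hW, b, hb, hb0, d, hd, hd0⟩ := hopen 0 h0
  obtain ⟨m, hm, hdm⟩ := hidx d (hS.subset W hW hd)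
  have hm0 : 0 < m := Nat.pos_of_ne_zero fun h => by
    subst h
    exact hd0 hdm
  exact main (m - 0) 0 m h0 hm hm0 rfl W hW b hb d hd hb0 hdm

/-- The alternating sum `∑ (-1)^|A| ∏_{p ∈ A} f(p) h(B ∪ ⋃_{p ∉ A} p)` over the subsets `A` of a
list of coloured sets. -/
def centered {M : Type*} [AddCommGroup M] [Module ℂ M] (f : Bool × Finset ι → ℂ)
    (h : Finset ι → M) : List (Bool × Finset ι) → Finset ι → M
  | [], B => h B
  | p :: Rs, B => centered f h Rs (B ∪ p.2) - f p • centered f h Rs B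

section Centered

variable {M : Type*} [AddCommGroup M] [Module ℂ M] (f : Bool × Finset ι → ℂ) (h : Finset ι → M)

theorem centered_map {N : Type*} [AddCommGroup N] [Module ℂ N] (g : M →ₗ[ℂ] N)
    (Rs : List (Bool × Finset ι)) : ∀ B,
    g (centered f h Rs B) = centered f (fun V => g (h V)) Rs B := by
  induction Rs with
  | nil => intro B; rfl
  | cons p Rs ih => intro B; simp only [centered, map_sub, map_smul, ih]

/-- The recursion peels off the first run; here the last one is peeled off instead, which is what
right operators require. -/
theorem centered_concat (Rs : List (Bool × Finset ι)) (p : Bool × Finset ι) : ∀ B,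
    centered f h (Rs ++ [p]) B = centered f h Rs (B ∪ p.2) - f p • centered f h Rs B := by
  induction Rs with
  | nil => intro B; rfl
  | cons q Rs ih =>
    intro B
    simp only [List.cons_append, centered, ih, smul_sub, union_right_comm B q.2 p.2]
    rw [smul_comm (f p) (f q)]
    abel

end Centered

theorem centered_congr {M : Type*} [AddCommGroup M] [Module ℂ M] (f : Bool × Finset ι → ℂ)
    {h g : Finset ι → M} (Rs : List (Bool × Finset ι)) : ∀ B,
    (∀ U ⊆ B ∪ nodes Rs, B ⊆ U → h U = g U) → centered f h Rs B = centered f g Rs B := by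
  induction Rs with
  | nil => exact fun B hB => hB B (by simp) subset_rfl
  | cons p Rs ih =>
    intro B hB
    rw [nodes_cons, ← union_assoc] at hB
    simp only [centered]
    rw [ih (B ∪ p.2) fun U hU hBU => hB U hU (subset_union_left.trans hBU),
      ih B fun U hU hBU => hB U (hU.trans (union_subset_union_left subset_union_left)) hBU]

/-- A function with vanishing centred sums is determined by its value on the empty set. -/
theorem eq_of_centered_eq {key : ι → ℤ} (hkey : Function.Injective key) (ε : ι → Bool)
    (f : Bool × Finset ι → ℂ) {h g : Finset ι → ℂ} (h0 : h ∅ = g ∅)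
    (hc : ∀ Rs, IsRuns key ε Rs → Rs ≠ [] → centered f h Rs ∅ = centered f g Rs ∅)
    (V : Finset ι) : h V = g V := by
  induction V using Finset.strongInduction with
  | H V ih =>
    obtain ⟨Rs, hR, rfl⟩ := exists_isRuns hkey ε V
    by_cases hne : Rs = []
    · subst hne
      exact h0
    -- Only the term in which no run is replaced by its weight takes the value at all of `nodes Rs`;
    -- every other term takes it at a proper subset, where the induction hypothesis applies. `B`
    -- collects the runs already kept.
    have key_lemma : ∀ Rs', Rs'.Pairwise (fun p q => ∀ a ∈ p.2, ∀ b ∈ q.2, key a < key b) →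
        (∀ p ∈ Rs', p.2.Nonempty) → ∀ B, B ∪ nodes Rs' = nodes Rs →
        (∀ p ∈ Rs', Disjoint B p.2) →
        centered f h Rs' B - h (nodes Rs) = centered f g Rs' B - g (nodes Rs) := by
      intro Rs'
      induction Rs' with
      | nil =>
        intro _ _ B hB _
        simp only [nodes_nil, union_empty] at hB
        simp [centered, hB]
      | cons p Rs' ih' =>
        intro hlt hn B hB hd
        have hlt' := List.pairwise_cons.1 hlt
        rw [nodes_cons, ← union_assoc] at hB
        have hdp : ∀ q ∈ Rs', Disjoint p.2 q.2 := fun q hq => disjoint_left.2 fun a ha ha' =>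
          lt_irrefl _ (hlt'.1 q hq a ha a ha')
        have h1 := ih' hlt'.2 (fun q hq => hn q (List.mem_cons_of_mem _ hq)) (B ∪ p.2) hB
          fun q hq => disjoint_union_left.2 ⟨hd q (List.mem_cons_of_mem _ hq), hdp q hq⟩
        -- Here `p` has been dropped; it is non-empty and disjoint from the rest, so only proper
        -- subsets of `nodes Rs` occur.
        have h2 : centered f h Rs' B = centered f g Rs' B := by
          refine centered_congr f Rs' B fun U hU _ => ih U ?_
          refine Finset.ssubset_iff_subset_ne.2 ⟨?_, ?_⟩
          · rw [← hB]
            exact hU.trans (union_subset_union_left subset_union_left)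
          · rintro rfl
            obtain ⟨a, ha⟩ := hn p List.mem_cons_self
            have haU : a ∈ B ∪ nodes Rs' :=
              hU (hB ▸ mem_union_left _ (mem_union_right _ ha))
            rcases mem_union.1 haU with haB | haR
            · exact disjoint_left.1 (hd p List.mem_cons_self) haB ha
            · obtain ⟨q, hq, haq⟩ := mem_nodes.1 haR
              exact disjoint_left.1 (hdp q hq) ha haq
        simp only [centered, h2]
        linear_combination h1
    have := key_lemma Rs hR.lt hR.nonempty ∅ (by simp) (by simp)
    rw [hc Rs hR hne] at this
    linear_combination -this

/-- Inclusion-exclusion. Each set `p` of the list is an interval of the underlying set, so nothing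
crosses it, and the partitions in which it is a union of blocks are exactly the pairs of a partition
of `p` and one of the complement. Their total is the term subtracted in the recursion. `B` is the
part on which no condition is imposed. -/
theorem centered_ncSum (key : ι → ℤ) (κ : Finset ι → ℂ) (Rs : List (Bool × Finset ι)) :
    ∀ B, Rs.Pairwise (fun p q => Disjoint p.2 q.2) → (∀ p ∈ Rs, Disjoint B p.2) →
    (∀ p ∈ Rs, ∀ a ∈ p.2, ∀ c ∈ p.2, ∀ b ∈ B ∪ nodes Rs, key a < key b → key b < key c →
      b ∈ p.2) →
    centered (fun p => ncSum key κ p.2) (ncSum key κ) Rs B =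
      ∑ S ∈ ncPartitions key (B ∪ nodes Rs) with ∀ p ∈ Rs, ¬ IsClosedIn S p.2,
        ∏ W ∈ S, κ W := by
  induction Rs with
  | nil =>
    intro B _ _ _
    simp [centered, ncSum]
  | cons p Rs ih =>
    intro B hpw hd hint
    have hpw' := List.pairwise_cons.1 hpw
    have hpR : Disjoint p.2 (B ∪ nodes Rs) := by
      refine disjoint_left.2 fun a ha h => ?_
      rcases mem_union.1 h with h | h
      · exact disjoint_left.1 (hd p List.mem_cons_self) h ha
      · obtain ⟨q, hq, haq⟩ := mem_nodes.1 h
        exact disjoint_left.1 (hpw'.1 q hq) ha haq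
    have hU : B ∪ nodes (p :: Rs) = p.2 ∪ (B ∪ nodes Rs) := by
      rw [nodes_cons, union_left_comm]
    simp only [centered, smul_eq_mul]
    rw [ih (B ∪ p.2) hpw'.2, ih B hpw'.2]
    · have hsplit := sum_ncPartitions_union (key := key) hpR
        (fun S => ∀ q ∈ Rs, ¬ IsClosedIn S q.2) ?_ κ
      · rw [← hsplit, hU, union_assoc, union_left_comm B, sub_eq_iff_eq_add, ← sum_union]
        · refine sum_congr ?_ fun _ _ => rfl
          ext S
          simp only [mem_union, mem_filter, ← and_or_left, mem_ncPartitions]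
          refine and_congr_right fun hS => ?_
          have hcl : IsClosedIn S p.2 ↔ ∀ W ∈ S, W ⊆ p.2 ∨ W ⊆ B ∪ nodes Rs := by
            refine forall₂_congr fun W hW => or_congr_right ?_
            constructor
            · intro hdis a ha
              exact (mem_union.1 (hS.subset W hW ha)).resolve_left (disjoint_left.1 hdis ha)
            · exact fun h => hpR.symm.mono_left h
          -- Once `p` is split off, its blocks are disjoint from every other run and have no
          -- influence on whether that run is a union of blocks.
          have hrest : IsClosedIn S p.2 → ∀ q ∈ Rs,
              (IsClosedIn (S.filter (· ⊆ B ∪ nodes Rs)) q.2 ↔ IsClosedIn S q.2) := by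
            intro hcp q hq
            constructor
            · intro h W hW
              rcases hcl.1 hcp W hW with h' | h'
              · exact Or.inr ((hpw'.1 q hq).mono_left h')
              · exact h W (mem_filter.2 ⟨hW, h'⟩)
            · exact fun h W hW => h W (mem_filter.1 hW).1
          rw [← hcl, List.forall_mem_cons]
          by_cases hcp : IsClosedIn S p.2
          · simp only [hcp, not_true_eq_false, false_and, true_and, false_or]
            exact forall₂_congr fun q hq => not_congr (hrest hcp q hq).symm
          · simp [hcp]
        · rw [disjoint_left]
          intro S h1 h2
          rw [mem_filter] at h1 h2
          have hS := mem_ncPartitions.1 h1.1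
          refine h1.2 p List.mem_cons_self fun W hW => ?_
          exact (h2.2.1 W hW).imp_right fun h => hpR.symm.mono_left h
      · intro S hS _ W hW
        rw [mem_ncPartitions] at hS
        have hWQ := hS.subset W hW
        constructor
        · rintro a ha b hb c hc d hd ⟨hab, hbc, -⟩
          have := hint p List.mem_cons_self a ha c hc b
            (by rw [hU]; exact mem_union_right _ (hWQ hb)) hab hbc
          exact disjoint_left.1 hpR this (hWQ hb)
        · rintro a ha b hb c hc d hd ⟨-, hbc, hcd⟩
          have := hint p List.mem_cons_self b hb d hd c
            (by rw [hU]; exact mem_union_right _ (hWQ hc)) hbc hcd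
          exact disjoint_left.1 hpR this (hWQ hc)
    · exact fun q hq => hd q (List.mem_cons_of_mem _ hq)
    · intro q hq a ha c hc b hb
      refine hint q (List.mem_cons_of_mem _ hq) a ha c hc b ?_
      rw [hU]
      exact mem_union_right _ hb
    · exact fun q hq => disjoint_union_left.2 ⟨hd q (List.mem_cons_of_mem _ hq), hpw'.1 q hq⟩
    · intro q hq a ha c hc b hb
      refine hint q (List.mem_cons_of_mem _ hq) a ha c hc b ?_
      rwa [nodes_cons, ← union_assoc]

/-- The centred sums of a sum over the non-crossing partitions with blocks of one colour
vanish. -/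
theorem centered_ncSum_eq_zero {key : ι → ℤ} {ε : ι → Bool} {κ : Finset ι → ℂ}
    (hκ : ∀ W : Finset ι, (∃ a ∈ W, ∃ b ∈ W, ε a ≠ ε b) → κ W = 0)
    {Rs : List (Bool × Finset ι)} (hR : IsRuns key ε Rs) (hne : Rs ≠ []) :
    centered (fun p => ncSum key κ p.2) (ncSum key κ) Rs ∅ = 0 := by
  have hlt := List.pairwise_iff_getElem.1 hR.lt
  rw [centered_ncSum key κ Rs ∅]
  · refine sum_eq_zero fun S hS => ?_
    rw [mem_filter, empty_union, mem_ncPartitions] at hS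
    by_contra hprod
    -- A non-zero product has only one-coloured blocks.
    obtain ⟨p, hp, hcl⟩ := exists_isClosedIn hR hne hS.1 fun W hW a ha b hb => by
      by_contra hab
      exact hprod (prod_eq_zero hW (hκ W ⟨a, ha, b, hb, hab⟩))
    exact hS.2 p hp hcl
  · exact hR.lt.imp fun h => disjoint_left.2 fun a ha ha' => lt_irrefl _ (h a ha a ha')
  · simp
  · intro p hp a ha c hc b hb hab hbc
    rw [empty_union] at hb
    obtain ⟨q, hq, hbq⟩ := mem_nodes.1 hb
    obtain ⟨i, hi, rfl⟩ := List.getElem_of_mem hp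
    obtain ⟨j, hj, rfl⟩ := List.getElem_of_mem hq
    rcases lt_trichotomy i j with h | rfl | h
    · exact absurd hbc (hlt i j hi hj h c hc b hbq).not_gt
    · exact hbq
    · exact absurd hab (hlt j i hj hi h b hbq a ha).not_gt

end

end Runs

/-! ### Moment-cumulant formula on subsets and Möbius inversion -/

section MobiusInversion

/-- The position of a node in the order given by `s_χ`: the left nodes in increasing order are
followed by the right nodes in decreasing order. -/
def nodeKey {n : ℕ} (χ : Fin n → Face) (a : Fin n) : ℤ :=
  if χ a = Face.left then (a : ℤ) - n else n - a

/-- Subtracting `n` makes the left keys negative, and the right keys are positive. This form of the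
order no longer mentions `n`, and so it passes to subtuples, whose keys are built from their own
length. -/
theorem nodeKey_lt_iff {n : ℕ} (χ : Fin n → Face) (a b : Fin n) :
    nodeKey χ a < nodeKey χ b ↔
      (χ a = Face.left ∧ χ b = Face.left ∧ a < b) ∨ (χ a = Face.left ∧ χ b = Face.right) ∨
        (χ a = Face.right ∧ χ b = Face.right ∧ b < a) := by
  have := a.2
  have := b.2
  cases ha : χ a <;> cases hb : χ b <;>
    simp [nodeKey, ha, hb] <;> omega

theorem nodeKey_injective {n : ℕ} (χ : Fin n → Face) : Function.Injective (nodeKey χ) := by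
  intro a b h
  have := a.2
  have := b.2
  apply Fin.ext
  cases ha : χ a <;> cases hb : χ b <;> simp [nodeKey, ha, hb] at h <;> omega

theorem nodeKey_restrictTo {n : ℕ} (χ : Fin n → Face) (V : Finset (Fin n)) (i j : Fin V.card) :
    nodeKey (restrictTo χ V) i < nodeKey (restrictTo χ V) j ↔
      nodeKey χ (V.orderEmbOfFin rfl i) < nodeKey χ (V.orderEmbOfFin rfl j) := by
  simp only [nodeKey_lt_iff, OrderEmbedding.lt_iff_lt, restrictTo]

theorem strictMono_nodeKey_sFun {n : ℕ} (χ : Fin n → Face) :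
    StrictMono fun p => nodeKey χ (sFun χ p) := by
  have hl : ∀ i, χ ((nodesOn χ Face.left).orderEmbOfFin rfl i) = Face.left := fun i => by
    simpa [nodesOn] using (nodesOn χ Face.left).orderEmbOfFin_mem rfl i
  have hr : ∀ i, χ ((nodesOn χ Face.right).orderEmbOfFin rfl i) = Face.right := fun i => by
    simpa [nodesOn] using (nodesOn χ Face.right).orderEmbOfFin_mem rfl i
  intro p q hpq
  have hpq' : (p : ℕ) < q := hpq
  have h1 := card_nodesOn χ
  have h2 := p.2
  have h3 := q.2
  rw [nodeKey_lt_iff]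
  unfold sFun
  split_ifs with hp hq hq
  · exact Or.inl ⟨hl _, hl _, by simpa using hpq⟩
  · exact Or.inr (Or.inl ⟨hl _, hr _⟩)
  · omega
  · refine Or.inr (Or.inr ⟨hr _, hr _, ?_⟩)
    rw [OrderEmbedding.lt_iff_lt, Fin.mk_lt_mk]
    omega

theorem isBiNonCrossing_iff {n : ℕ} (χ : Fin n → Face)
    (π : Finpartition (univ : Finset (Fin n))) :
    IsBiNonCrossing χ π ↔
      ∀ V ∈ π.parts, ∀ W ∈ π.parts, V ≠ W → NonCross (nodeKey χ) V W := by
  have hlt : ∀ a b, (sPerm χ).symm a < (sPerm χ).symm b ↔ nodeKey χ a < nodeKey χ b := by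
    intro a b
    rw [← (strictMono_nodeKey_sFun χ).lt_iff_lt]
    change nodeKey χ (sPerm χ _) < nodeKey χ (sPerm χ _) ↔ _
    rw [Equiv.apply_symm_apply, Equiv.apply_symm_apply]
  have hinj : Function.Injective fun V : Finset (Fin n) => V.image (sPerm χ).symm :=
    Finset.image_injective (sPerm χ).symm.injective
  simp only [IsBiNonCrossing, IsNonCrossing, forall_mem_image, NonCross, hlt, hinj.ne_iff]

theorem isNCPartition_parts {n : ℕ} {χ : Fin n → Face} (π : BNC χ) :
    IsNCPartition (nodeKey χ) univ π.1.parts where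
  subset W _ := subset_univ W
  cover _ ha := π.1.exists_mem ha
  nonempty _ hW := π.1.nonempty_of_mem_parts hW
  eq_of_mem _ hW _ hW' _ ha ha' := π.1.eq_of_mem_parts hW hW' ha ha'
  nonCross := (isBiNonCrossing_iff χ π.1).1 π.2

theorem exists_parts_eq {n : ℕ} {χ : Fin n → Face} {S : Finset (Finset (Fin n))}
    (hS : IsNCPartition (nodeKey χ) univ S) : ∃ π : BNC χ, π.1.parts = S := by
  refine ⟨⟨⟨S, ?_, ?_, ?_⟩, (isBiNonCrossing_iff χ _).2 hS.nonCross⟩, rfl⟩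
  · rw [Finset.supIndep_iff_pairwiseDisjoint]
    intro W hW W' hW' hne
    exact disjoint_left.2 fun a ha ha' => hne (hS.eq_of_mem W hW W' hW' a ha ha')
  · refine eq_univ_of_forall fun a => ?_
    obtain ⟨W, hW, ha⟩ := hS.cover a (mem_univ a)
    exact mem_sup.2 ⟨W, hW, ha⟩
  · exact fun h => not_nonempty_empty (hS.nonempty _ h)

theorem sum_BNC {n : ℕ} (χ : Fin n → Face) (F : Finset (Finset (Fin n)) → ℂ) :
    ∑ π : BNC χ, F π.1.parts = ∑ S ∈ ncPartitions (nodeKey χ) univ, F S := by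
  refine sum_nbij (fun π => π.1.parts) (fun π _ => mem_ncPartitions.2 (isNCPartition_parts π))
    (fun π _ σ _ h => Subtype.ext (Finpartition.ext h)) (fun S hS => ?_) fun _ _ => rfl
  obtain ⟨π, hπ⟩ := exists_parts_eq (mem_ncPartitions.1 hS)
  exact ⟨π, by simp, hπ⟩

/-- Non-crossing depends only on the order of the keys. This transports sums from `Fin V.card`,
where the cumulants of a subtuple live, to the subset `V`. -/
theorem ncSum_map {ι ι' : Type*} [DecidableEq ι] [DecidableEq ι'] (e : ι' ↪ ι) {key : ι → ℤ} {key' : ι' → ℤ}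
    (hkey : ∀ i j, key' i < key' j ↔ key (e i) < key (e j)) (κ : Finset ι → ℂ) (U : Finset ι') :
    ncSum key κ (U.map e) = ncSum key' (fun W => κ (W.map e)) U := by
  symm
  refine sum_nbij (fun S => S.map (mapEmbedding e).toEmbedding) (fun S hS => ?_)
    (map_injective _).injOn (fun T hT => ?_) fun S _ => ?_
  · rw [mem_ncPartitions] at hS ⊢
    refine ⟨?_, ?_, ?_, ?_, ?_⟩
    · simp only [forall_mem_map]
      exact fun W hW => map_subset_map.2 (hS.subset W hW)
    · simp only [forall_mem_map]
      intro a ha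
      obtain ⟨W, hW, haW⟩ := hS.cover a ha
      exact ⟨W.map e, mem_map_of_mem (mapEmbedding e).toEmbedding hW, mem_map_of_mem e haW⟩
    · simp only [forall_mem_map]
      exact fun W hW => (hS.nonempty W hW).map
    · simp only [forall_mem_map]
      intro W hW W' hW' x hx hx'
      obtain ⟨a, ha, rfl⟩ := mem_map.1 hx
      rw [hS.eq_of_mem W hW W' hW' a ha ((mem_map' e).1 hx')]
    · simp only [forall_mem_map]
      intro W hW W' hW' hne
      have h := hS.nonCross W hW W' hW' fun h => hne (h ▸ rfl)
      intro x hx y hy z hz t ht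
      obtain ⟨a, ha, rfl⟩ := mem_map.1 hx
      obtain ⟨b, hb, rfl⟩ := mem_map.1 hy
      obtain ⟨c, hc, rfl⟩ := mem_map.1 hz
      obtain ⟨d, hd, rfl⟩ := mem_map.1 ht
      rw [← hkey, ← hkey, ← hkey]
      exact h a ha b hb c hc d hd
  · rw [mem_coe, mem_ncPartitions] at hT
    have hpre : ∀ W ∈ T, ∃ W' ⊆ U, W'.map e = W := by
      intro W hW
      obtain ⟨W', hW', h⟩ := subset_map_iff.1 (hT.subset W hW)
      exact ⟨W', hW', h.symm⟩
    refine ⟨U.powerset.filter fun W => W.map e ∈ T, ?_, ?_⟩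
    · rw [mem_coe, mem_ncPartitions]
      refine ⟨?_, ?_, ?_, ?_, ?_⟩
      · exact fun W hW => mem_powerset.1 (mem_filter.1 hW).1
      · intro a ha
        obtain ⟨W, hW, haW⟩ := hT.cover (e a) (mem_map_of_mem e ha)
        obtain ⟨W', hW', rfl⟩ := hpre W hW
        exact ⟨W', mem_filter.2 ⟨mem_powerset.2 hW', hW⟩, (mem_map' e).1 haW⟩
      · exact fun W hW => map_nonempty.1 (hT.nonempty _ (mem_filter.1 hW).2)
      · intro W hW W' hW' a ha ha'
        exact map_injective e (hT.eq_of_mem _ (mem_filter.1 hW).2 _ (mem_filter.1 hW').2 (e a)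
          (mem_map_of_mem e ha) (mem_map_of_mem e ha'))
      · intro W hW W' hW' hne a ha b hb c hc d hd
        rw [hkey, hkey, hkey]
        exact hT.nonCross _ (mem_filter.1 hW).2 _ (mem_filter.1 hW').2
          ((map_injective e).ne hne) _ (mem_map_of_mem e ha) _ (mem_map_of_mem e hb) _
          (mem_map_of_mem e hc) _ (mem_map_of_mem e hd)
    · ext W
      simp only [mem_map, mem_filter, mem_powerset]
      constructor
      · rintro ⟨W', ⟨-, h⟩, rfl⟩
        exact h
      · intro hW
        obtain ⟨W', hW', rfl⟩ := hpre W hW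
        exact ⟨W', ⟨hW', hW⟩, rfl⟩
  · rw [prod_map]
    rfl

section

variable {A : Type*} [Ring A] [Algebra ℂ A]

/-- The moment of the subtuple on `V`. -/
def blockMoment (φ : A →ₗ[ℂ] ℂ) {n : ℕ} (T : Fin n → A) (V : Finset (Fin n)) : ℂ :=
  moment φ (restrictTo T V)

/-- The cumulant of the subtuple on `V`. -/
noncomputable def blockCumulant (φ : A →ₗ[ℂ] ℂ) {n : ℕ} (χ : Fin n → Face) (T : Fin n → A)
    (V : Finset (Fin n)) : ℂ :=
  cumulant φ V.card (restrictTo χ V) (restrictTo T V)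

theorem blockCumulant_univ (φ : A →ₗ[ℂ] ℂ) {n : ℕ} (χ : Fin n → Face) (T : Fin n → A) :
    blockCumulant φ χ T univ = cumulant φ n χ T :=
  cumulant_restrictTo_univ φ n χ T

theorem moment_eq_ncSum (φ : A →ₗ[ℂ] ℂ) (n : ℕ) [NeZero n] (χ : Fin n → Face) (T : Fin n → A) :
    moment φ T = ncSum (nodeKey χ) (blockCumulant φ χ T) univ := by
  rw [moment_eq_sum_cumulant φ n χ T]
  exact sum_BNC χ fun S => ∏ W ∈ S, blockCumulant φ χ T W

/-- Restricting twice is restricting to the image, since increasing enumerations compose. The number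
of elements of the image equals `W.card` only propositionally, whence the detour through `hcast`. -/
theorem blockCumulant_restrictTo (φ : A →ₗ[ℂ] ℂ) {n : ℕ} (χ : Fin n → Face) (T : Fin n → A)
    (V : Finset (Fin n)) (W : Finset (Fin V.card)) :
    blockCumulant φ (restrictTo χ V) (restrictTo T V) W =
      blockCumulant φ χ T (W.map (V.orderEmbOfFin rfl).toEmbedding) := by
  have hcast : ∀ (s : Finset (Fin n)) (m : ℕ) (h : s.card = m),
      cumulant φ m (fun i => χ (s.orderEmbOfFin h i)) (fun i => T (s.orderEmbOfFin h i)) =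
        blockCumulant φ χ T s := by
    rintro s m rfl
    rfl
  rw [← hcast _ W.card (card_map _)]
  have h : ∀ i, V.orderEmbOfFin rfl (W.orderEmbOfFin rfl i) =
      (W.map (V.orderEmbOfFin rfl).toEmbedding).orderEmbOfFin (card_map _) i := fun i =>
    congrFun (orderEmbOfFin_unique (card_map _)
      (f := fun i => V.orderEmbOfFin rfl (W.orderEmbOfFin rfl i))
      (fun i => mem_map_of_mem (V.orderEmbOfFin rfl).toEmbedding (orderEmbOfFin_mem W rfl i))
      ((V.orderEmbOfFin rfl).strictMono.comp (W.orderEmbOfFin rfl).strictMono)) i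
  simp only [← h]
  rfl

theorem blockMoment_eq_ncSum (φ : A →ₗ[ℂ] ℂ) {n : ℕ} (χ : Fin n → Face) (T : Fin n → A)
    {V : Finset (Fin n)} (hV : V.Nonempty) :
    blockMoment φ T V = ncSum (nodeKey χ) (blockCumulant φ χ T) V := by
  have : NeZero V.card := ⟨hV.card_pos.ne'⟩
  rw [blockMoment, moment_eq_ncSum φ V.card (restrictTo χ V)]
  have hm : V = univ.map (V.orderEmbOfFin rfl).toEmbedding := by
    rw [Finset.map_orderEmbOfFin_univ]
  conv_rhs => rw [hm]
  rw [ncSum_map _ fun i j => nodeKey_restrictTo χ V i j]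
  exact ncSum_congr fun W _ _ => blockCumulant_restrictTo φ χ T V W

theorem parts_oneBNC {n : ℕ} [NeZero n] (χ : Fin n → Face) : (oneBNC χ).1.parts = {univ} :=
  Finset.Nonempty.subset_singleton_iff
    (Finpartition.parts_nonempty _ Finset.univ_nonempty.ne_empty) |>.mp
      (Finpartition.parts_top_subset _)

/-- Möbius inversion of the moment-cumulant formula. -/
theorem cumulant_eq_sum_muBNC (φ : A →ₗ[ℂ] ℂ) (n : ℕ) [NeZero n] (χ : Fin n → Face)
    (T : Fin n → A) :
    cumulant φ n χ T =
      ∑ π : BNC χ, muBNC χ π (oneBNC χ) * ∏ V ∈ π.1.parts, blockMoment φ T V := by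
  classical
  -- The factorization over refinements: products of moments are the zeta transform of products of
  -- cumulants.
  have hprod : ∀ π : BNC χ, ∏ V ∈ π.1.parts, blockMoment φ T V =
      ∑ σ : BNC χ, if σ ≤ π then ∏ W ∈ σ.1.parts, blockCumulant φ χ T W else 0 := by
    intro π
    have h := sum_ncPartitions_refine (nodeKey χ) (blockCumulant φ χ T) π.1.parts univ
      (isNCPartition_parts π)
    rw [prod_congr rfl fun V hV => blockMoment_eq_ncSum φ χ T (π.1.nonempty_of_mem_parts hV), ← h,
      sum_filter]
    refine Eq.trans (sum_congr rfl fun S _ => ?_) ((sum_BNC χ fun S =>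
      if (∀ W ∈ S, ∃ P ∈ π.1.parts, W ⊆ P) then
        ∏ W ∈ S, blockCumulant φ χ T W else 0).symm.trans ?_)
    · congr
    refine sum_congr rfl fun σ _ => ?_
    have : σ ≤ π ↔ ∀ W ∈ σ.1.parts, ∃ P ∈ π.1.parts, W ⊆ P :=
      ⟨fun h W hW => h hW, fun h W hW => h W hW⟩
    simp only [this]
  simp only [hprod, mul_sum]
  rw [sum_comm]
  -- After exchanging the sums, the coefficient of the cumulants of `σ` is `∑ μ(π, 1)` over the
  -- interval from `σ` to the maximum, which is zero unless `σ` is the maximum.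
  have hmu : ∀ σ : BNC χ, ∑ π : BNC χ, muBNC χ π (oneBNC χ) *
      (if σ ≤ π then ∏ W ∈ σ.1.parts, blockCumulant φ χ T W else 0) =
      if σ = oneBNC χ then ∏ W ∈ σ.1.parts, blockCumulant φ χ T W else 0 := by
    intro σ
    have hIcc : Icc σ (oneBNC χ) = univ.filter fun π => σ ≤ π := by
      ext π
      simp [le_oneBNC]
    have h := IncidenceAlgebra.sum_Icc_mu_left (𝕜 := ℂ) σ (oneBNC χ)
    rw [hIcc, sum_filter] at h
    simp only [mul_ite, mul_zero]
    calc _ = (∑ π : BNC χ, if σ ≤ π then IncidenceAlgebra.mu ℂ π (oneBNC χ) else 0) *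
          ∏ W ∈ σ.1.parts, blockCumulant φ χ T W := by
          rw [sum_mul]
          refine sum_congr rfl fun π _ => ?_
          split_ifs <;> simp [muBNC]
      _ = _ := by
          rw [h]
          split_ifs <;> simp
  simp only [hmu]
  rw [sum_ite_eq' univ (oneBNC χ), if_pos (mem_univ _), parts_oneBNC, prod_singleton,
    blockCumulant_univ]

end

end MobiusInversion

/-! ### Products in increasing order -/

section OrderedProducts

variable {n : ℕ} {M : Type*} [Monoid M]

/-- The product of the `f k`, `k ∈ V`, in increasing order. -/
def orderedProd (f : Fin n → M) (V : Finset (Fin n)) : M := ((V.sort (· ≤ ·)).map f).prod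

@[simp] theorem orderedProd_empty (f : Fin n → M) : orderedProd f ∅ = 1 := by
  simp [orderedProd]

theorem orderedProd_insert (f : Fin n → M) {k : Fin n} {V : Finset (Fin n)}
    (h : ∀ b ∈ V, k < b) : orderedProd f (insert k V) = f k * orderedProd f V := by
  rw [orderedProd, Finset.sort_insert (r := (· ≤ ·)) (fun b hb => (h b hb).le)
    (fun hk => lt_irrefl k (h k hk)), List.map_cons, List.prod_cons, orderedProd]

theorem orderedProd_congr {f g : Fin n → M} {V : Finset (Fin n)} (h : ∀ k ∈ V, f k = g k) :
    orderedProd f V = orderedProd g V := by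
  rw [orderedProd, orderedProd, List.map_congr_left fun k hk => h k ((mem_sort _).1 hk)]

theorem blockMoment_eq_orderedProd {A : Type*} [Ring A] [Algebra ℂ A] (φ : A →ₗ[ℂ] ℂ)
    (T : Fin n → A) (V : Finset (Fin n)) : blockMoment φ T V = φ (orderedProd T V) := by
  rw [blockMoment, moment, orderedProd]
  congr 2
  refine List.ext_getElem (by simp) fun i h1 h2 => ?_
  simp [restrictTo, orderEmbOfFin_apply]

end OrderedProducts

/-! ### Moments in the free product of pointed spaces -/

section FreeProductMoments

variable (X : Bool → PointedSpace.{w})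

/-- The tensor with the given letters. -/
noncomputable def tensor (L : List (Σ ε, (X ε).red)) : FockAlg X :=
  (L.map fun a => letter X a.1 a.2).prod

@[simp] theorem tensor_nil : tensor X [] = 1 := rfl

theorem tensor_cons (a : Σ ε, (X ε).red) (L : List (Σ ε, (X ε).red)) :
    tensor X (a :: L) = letter X a.1 a.2 * tensor X L := by
  simp [tensor]

theorem tensor_concat (a : Σ ε, (X ε).red) (L : List (Σ ε, (X ε).red)) :
    tensor X (L ++ [a]) = tensor X L * letter X a.1 a.2 := by
  simp [tensor]

theorem incl_apply (ε : Bool) (x : X ε) :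
    incl X ε x = (X ε).state x • (1 : FockAlg X) + letter X ε ((X ε).toRed x) := by
  simp [incl, Algebra.algebraMap_eq_smul_one]

theorem incl_vec (ε : Bool) : incl X ε (X ε).vec = 1 := by
  have h : (X ε).toRed (X ε).vec = 0 := Subtype.ext (by
    rw [PointedSpace.toRed_apply, (X ε).state_vec, one_smul, sub_self, ZeroMemClass.coe_zero])
  rw [incl_apply, (X ε).state_vec, h, map_zero, one_smul, add_zero]

theorem incl_map (ε : Bool) (T : Module.End ℂ (X ε)) (x : X ε) :
    incl X ε (T x) = (X ε).state x • incl X ε (T (X ε).vec) +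
      incl X ε (T ((X ε).toRed x : X ε)) := by
  rw [← map_smul, ← map_smul, ← map_add, ← map_add, PointedSpace.toRed_apply, add_sub_cancel]

theorem leftOp_tensor {ε : Bool} (T : Module.End ℂ (X ε)) {L : List (Σ ε, (X ε).red)}
    (hL : ∀ a ∈ L.head?, a.1 ≠ ε) :
    leftOp X ε T (tensor X L) = incl X ε (T (X ε).vec) * tensor X L := by
  cases L with
  | nil => rw [tensor_nil, mul_one]; exact onFirst_one _ _
  | cons a L =>
    obtain ⟨δ, y⟩ := a
    have hδ : δ ≠ ε := hL ⟨δ, y⟩ (by simp)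
    rw [tensor_cons, ← mul_assoc]
    refine (onFirst_mul _ _ _ _).trans ?_
    rw [leftLetter_single, dif_neg hδ]

/-- The defining property of the left representation. The `ξ`-part of `x` leaves a tensor not
starting with shade `ε`, and the reduced part is an honest first letter; the two contributions
recombine by `incl_map`. -/
theorem leftOp_incl_mul {ε : Bool} (T : Module.End ℂ (X ε)) (x : X ε)
    {L : List (Σ ε, (X ε).red)} (hL : ∀ a ∈ L.head?, a.1 ≠ ε) :
    leftOp X ε T (incl X ε x * tensor X L) = incl X ε (T x) * tensor X L := by
  have h : leftOp X ε T (letter X ε ((X ε).toRed x) * tensor X L) =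
      incl X ε (T ((X ε).toRed x : X ε)) * tensor X L := by
    refine (onFirst_mul _ _ _ _).trans ?_
    rw [leftLetter_single, dif_pos rfl]
  rw [incl_apply, add_mul, map_add, h, smul_mul_assoc, one_mul, map_smul, leftOp_tensor X T hL,
    incl_map X ε T x, add_mul, smul_mul_assoc]

theorem rightOp_tensor {ε : Bool} (T : Module.End ℂ (X ε)) {L : List (Σ ε, (X ε).red)}
    (hL : ∀ a ∈ L.getLast?, a.1 ≠ ε) :
    rightOp X ε T (tensor X L) = tensor X L * incl X ε (T (X ε).vec) := by
  rcases List.eq_nil_or_concat' L with rfl | ⟨L, ⟨δ, y⟩, rfl⟩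
  · rw [tensor_nil, one_mul]; exact onLast_one _ _
  · have hδ : δ ≠ ε := hL ⟨δ, y⟩ (by simp)
    rw [tensor_concat, mul_assoc]
    refine (onLast_mul _ _ _ _).trans ?_
    rw [rightLetter_single, dif_neg hδ]

theorem rightOp_mul_incl {ε : Bool} (T : Module.End ℂ (X ε)) (x : X ε)
    {L : List (Σ ε, (X ε).red)} (hL : ∀ a ∈ L.getLast?, a.1 ≠ ε) :
    rightOp X ε T (tensor X L * incl X ε x) = tensor X L * incl X ε (T x) := by
  have h : rightOp X ε T (tensor X L * letter X ε ((X ε).toRed x)) =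
      tensor X L * incl X ε (T ((X ε).toRed x : X ε)) := by
    refine (onLast_mul _ _ _ _).trans ?_
    rw [rightLetter_single, dif_pos rfl]
  rw [incl_apply, mul_add, map_add, h, mul_smul_comm, mul_one, map_smul, rightOp_tensor X T hL,
    incl_map X ε T x, mul_add, mul_smul_comm]

variable {n : ℕ} (χ : Fin n → Face) (ε : Fin n → Bool)
  (T : ∀ δ, Fin n → Module.End ℂ (X δ))

/-- The operator of shade `ε k` and face `χ k` on the tensors. -/
noncomputable def nodeOp (k : Fin n) : Module.End ℂ (FockAlg X) :=
  match χ k with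
  | Face.left => leftOp X (ε k) (T (ε k) k)
  | Face.right => rightOp X (ε k) (T (ε k) k)

/-- The vector obtained by applying the operators in `V` to the state-vector. -/
noncomputable def wordVec (V : Finset (Fin n)) : FockAlg X :=
  orderedProd (nodeOp X χ ε T) V 1

/-- The vector obtained by applying the operators in `V` to the state-vector of `X δ`. -/
noncomputable def blockVec (δ : Bool) (V : Finset (Fin n)) : X δ :=
  orderedProd (T δ) V (X δ).vec

/-- The reduced vectors of a list of runs. -/
noncomputable def runLetters (Rs : List (Bool × Finset (Fin n))) : List (Σ ε, (X ε).red) :=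
  Rs.map fun p => ⟨p.1, (X p.1).toRed (blockVec X T p.1 p.2)⟩

theorem wordVec_insert {k : Fin n} {V : Finset (Fin n)} (h : ∀ b ∈ V, k < b) :
    wordVec X χ ε T (insert k V) = nodeOp X χ ε T k (wordVec X χ ε T V) := by
  rw [wordVec, orderedProd_insert _ h, Module.End.mul_apply, wordVec]

theorem blockVec_insert (δ : Bool) {k : Fin n} {V : Finset (Fin n)} (h : ∀ b ∈ V, k < b) :
    blockVec X T δ (insert k V) = T δ k (blockVec X T δ V) := by
  rw [blockVec, orderedProd_insert _ h, Module.End.mul_apply, blockVec]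

theorem centered_insert {M : Type*} [AddCommGroup M] [Module ℂ M]
    (f : Bool × Finset (Fin n) → ℂ) (h : Finset (Fin n) → M) (k : Fin n)
    (Rs : List (Bool × Finset (Fin n))) : ∀ B,
    centered f h Rs (insert k B) = centered f (fun V => h (insert k V)) Rs B := by
  induction Rs with
  | nil => exact fun B => rfl
  | cons p Rs ih =>
    intro B
    simp only [centered]
    rw [← ih, ← ih]
    congr 2
    ext
    simp

theorem centered_wordVec_insert (f : Bool × Finset (Fin n) → ℂ) {k : Fin n}
    (Rs : List (Bool × Finset (Fin n))) (B : Finset (Fin n)) (h : ∀ b ∈ B ∪ nodes Rs, k < b) :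
    centered f (wordVec X χ ε T) Rs (insert k B) =
      nodeOp X χ ε T k (centered f (wordVec X χ ε T) Rs B) := by
  rw [centered_insert, centered_map]
  exact centered_congr f Rs B fun U hU _ => wordVec_insert X χ ε T fun b hb => h b (hU hb)

/-- The centred sum of the vectors `S_V ξ` over a list of runs is the tensor of the reduced
vectors of the runs. -/
theorem centered_wordVec (Rs : List (Bool × Finset (Fin n))) (hR : IsRuns (nodeKey χ) ε Rs) :
    centered (fun p => (X p.1).state (blockVec X T p.1 p.2)) (wordVec X χ ε T) Rs ∅ =
      tensor X (runLetters X T Rs) := by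
  induction hN : (nodes Rs).card using Nat.strong_induction_on generalizing Rs with
  | _ N ih =>
  by_cases hne : Rs = []
  · subst hne
    simp [centered, wordVec, runLetters]
  have hnn : (nodes Rs).Nonempty := by
    obtain ⟨p, hp⟩ := List.exists_mem_of_ne_nil Rs hne
    obtain ⟨a, ha⟩ := hR.nonempty p hp
    exact ⟨a, mem_nodes.2 ⟨p, hp, ha⟩⟩
  -- The smallest node is the leftmost factor of every product that contains it, so its operator is
  -- applied last and can be pulled out of the alternating sum.
  obtain ⟨k, hk, hmin⟩ := exists_min_image (nodes Rs) id hnn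
  have hmin' : ∀ b ∈ nodes Rs, b ≠ k → k < b := fun b hb hbk =>
    lt_of_le_of_ne (hmin b hb) (Ne.symm hbk)
  cases hχ : χ k with
  | left =>
    -- A smallest node that is left also has the smallest key; hence it belongs to the first run and
    -- its operator acts on the first letter.
    have hkey : ∀ b ∈ nodes Rs, b ≠ k → nodeKey χ k < nodeKey χ b := by
      intro b hb hbk
      rw [nodeKey_lt_iff]
      cases hb' : χ b
      · exact Or.inl ⟨hχ, rfl, hmin' b hb hbk⟩
      · exact Or.inr (Or.inl ⟨hχ, rfl⟩)
    obtain ⟨⟨δ, I⟩, Rs, rfl⟩ := List.exists_cons_of_ne_nil hne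
    have hlt := List.pairwise_cons.1 hR.lt
    have hkR : k ∉ nodes Rs := by
      intro h
      obtain ⟨q, hq, hkq⟩ := mem_nodes.1 h
      obtain ⟨a, ha⟩ := hR.nonempty _ List.mem_cons_self
      have h1 := hlt.1 q hq a ha k hkq
      exact (hkey a (mem_union_left _ ha) (fun h => lt_irrefl _ (h ▸ h1))).not_gt h1
    have hkI : k ∈ I := (mem_union.1 hk).resolve_right hkR
    have hδ : ε k = δ := hR.color _ List.mem_cons_self k hkI
    subst hδ
    have hI : I = insert k (I.erase k) := (insert_erase hkI).symm
    have hge : ∀ b ∈ I.erase k ∪ nodes Rs, k < b := by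
      intro b hb
      refine hmin' b ?_ ?_
      · exact union_subset_union_left (erase_subset k I) hb
      · rintro rfl
        rcases mem_union.1 hb with hb | hb
        · exact notMem_erase _ _ hb
        · exact hkR hb
    have h2 := ih (nodes Rs).card (hN ▸ card_lt_card ((ssubset_iff_of_subset
      subset_union_right).2 ⟨k, hk, hkR⟩)) Rs hR.tail rfl
    -- Without `k`, the uncentred first run contributes its full vector. The induction hypothesis
    -- gives the reduced part for the shortened run, and the term with the run dropped gives the
    -- multiple of `ξ`. If `k` was the whole run, the vector is `ξ`, which `incl` sends to `1`.
    have h1 : centered (fun p => (X p.1).state (blockVec X T p.1 p.2)) (wordVec X χ ε T) Rs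
        (I.erase k) =
        incl X (ε k) (blockVec X T (ε k) (I.erase k)) * tensor X (runLetters X T Rs) := by
      rcases (I.erase k).eq_empty_or_nonempty with he | he
      · rw [he, h2, blockVec, orderedProd_empty, Module.End.one_apply, incl_vec, one_mul]
      · have h3 := ih (nodes ((ε k, I.erase k) :: Rs)).card (hN ▸ card_lt_card ?_)
          ((ε k, I.erase k) :: Rs) ⟨?_, ?_, ?_, ?_⟩ rfl
        · rw [centered, h2, empty_union, sub_eq_iff_eq_add] at h3
          rw [h3, incl_apply, add_mul, smul_mul_assoc, one_mul, add_comm]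
          simp [runLetters, tensor_cons]
        · refine (ssubset_iff_of_subset (union_subset_union_left (erase_subset k I))).2
            ⟨k, hk, fun h => ?_⟩
          exact lt_irrefl k (hge k h)
        · exact List.pairwise_cons.2 ⟨fun q hq a ha => hlt.1 q hq a (mem_of_mem_erase ha), hlt.2⟩
        · intro q hq
          rcases List.mem_cons.1 hq with rfl | hq
          · exact he
          · exact hR.tail.nonempty q hq
        · intro q hq a ha
          rcases List.mem_cons.1 hq with rfl | hq
          · exact hR.color _ List.mem_cons_self a (mem_of_mem_erase ha)
          · exact hR.tail.color q hq a ha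
        · exact List.isChain_cons.2 (List.isChain_cons.1 hR.chain)
    have hhead : ∀ a ∈ (runLetters X T Rs).head?, a.1 ≠ ε k := by
      have := (List.isChain_cons.1 hR.chain).1
      cases Rs with
      | nil => simp [runLetters]
      | cons q Rs => simpa [runLetters] using Ne.symm (this q (by simp))
    have hop : nodeOp X χ ε T k = leftOp X (ε k) (T (ε k) k) := by
      rw [nodeOp, hχ]
    rw [centered, h2, empty_union]
    conv_lhs => enter [1]; rw [hI]
    -- The operator of `k` completes the vector of the first run, and the subtracted term removes
    -- its `ξ`-part, leaving the reduced letter.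
    rw [centered_wordVec_insert X χ ε T _ Rs _ hge, h1, hop, leftOp_incl_mul X _ _ hhead,
      ← blockVec_insert X T (ε k) fun b hb => hge b (mem_union_left _ hb), ← hI,
      incl_apply, add_mul, smul_mul_assoc, one_mul, add_sub_cancel_left]
    simp [runLetters, tensor_cons]
  | right =>
    -- Right nodes are listed in decreasing order after the left ones, so a smallest node that is
    -- right has the largest key. The argument is mirrored, with the last run and the last letter.
    have hkey : ∀ b ∈ nodes Rs, b ≠ k → nodeKey χ b < nodeKey χ k := by
      intro b hb hbk
      rw [nodeKey_lt_iff]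
      cases hb' : χ b
      · exact Or.inr (Or.inl ⟨rfl, hχ⟩)
      · exact Or.inr (Or.inr ⟨rfl, hχ, hmin' b hb hbk⟩)
    obtain ⟨Rs, ⟨δ, I⟩, rfl⟩ := (List.eq_nil_or_concat' Rs).resolve_left hne
    have hlt := List.pairwise_append.1 hR.lt
    have hlt2 : ∀ q ∈ Rs, ∀ a ∈ q.2, ∀ b ∈ I, nodeKey χ a < nodeKey χ b := fun q hq =>
      hlt.2.2 q hq (δ, I) List.mem_cons_self
    have hmem : (δ, I) ∈ Rs ++ [(δ, I)] := by simp
    have hnod : ∀ J, nodes (Rs ++ [(δ, J)]) = nodes Rs ∪ J := fun J => by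
      rw [nodes_append, nodes_cons, nodes_nil, union_empty]
    have hinit : IsRuns (nodeKey χ) ε Rs :=
      ⟨hlt.1, fun p hp => hR.nonempty p (List.mem_append_left _ hp),
        fun p hp => hR.color p (List.mem_append_left _ hp), (List.isChain_append.1 hR.chain).1⟩
    rw [hnod] at hk hmin hmin' hkey hN
    have hkR : k ∉ nodes Rs := by
      intro h
      obtain ⟨q, hq, hkq⟩ := mem_nodes.1 h
      obtain ⟨a, ha⟩ := hR.nonempty _ hmem
      have h1 := hlt2 q hq k hkq a ha
      exact (hkey a (mem_union_right _ ha) (fun h => lt_irrefl _ (h ▸ h1))).not_gt h1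
    have hkI : k ∈ I := (mem_union.1 hk).resolve_left hkR
    have hδ : ε k = δ := hR.color _ hmem k hkI
    subst hδ
    have hI : I = insert k (I.erase k) := (insert_erase hkI).symm
    have hge : ∀ b ∈ I.erase k ∪ nodes Rs, k < b := by
      intro b hb
      refine hmin' b ?_ ?_
      · rw [union_comm]
        exact union_subset_union_left (erase_subset k I) hb
      · rintro rfl
        rcases mem_union.1 hb with hb | hb
        · exact notMem_erase _ _ hb
        · exact hkR hb
    have h2 := ih (nodes Rs).card (hN ▸ card_lt_card ((ssubset_iff_of_subset
      subset_union_left).2 ⟨k, hk, hkR⟩)) Rs hinit rfl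
    have hlet : ∀ J, tensor X (runLetters X T (Rs ++ [(ε k, J)])) =
        tensor X (runLetters X T Rs) *
          letter X (ε k) ((X (ε k)).toRed (blockVec X T (ε k) J)) := fun J => by
      simp [runLetters, tensor_concat]
    have h1 : centered (fun p => (X p.1).state (blockVec X T p.1 p.2)) (wordVec X χ ε T) Rs
        (I.erase k) =
        tensor X (runLetters X T Rs) * incl X (ε k) (blockVec X T (ε k) (I.erase k)) := by
      rcases (I.erase k).eq_empty_or_nonempty with he | he
      · rw [he, h2, blockVec, orderedProd_empty, Module.End.one_apply, incl_vec, mul_one]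
      · have h3 := ih (nodes (Rs ++ [(ε k, I.erase k)])).card (hN ▸ card_lt_card ?_)
          (Rs ++ [(ε k, I.erase k)]) ⟨?_, ?_, ?_, ?_⟩ rfl
        · rw [centered_concat, h2, empty_union, sub_eq_iff_eq_add, hlet] at h3
          rw [h3, incl_apply, mul_add, mul_smul_comm, mul_one, add_comm]
        · rw [hnod]
          refine (ssubset_iff_of_subset (union_subset_union_right (erase_subset k I))).2
            ⟨k, hk, fun h => ?_⟩
          rw [union_comm] at h
          exact lt_irrefl k (hge k h)
        · refine List.pairwise_append.2 ⟨hlt.1, List.pairwise_singleton _ _, fun q hq p hp => ?_⟩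
          rw [List.mem_singleton.1 hp]
          exact fun a ha b hb => hlt2 q hq a ha b (mem_of_mem_erase hb)
        · intro q hq
          rcases List.mem_append.1 hq with hq | hq
          · exact hinit.nonempty q hq
          · rw [List.mem_singleton.1 hq]
            exact he
        · intro q hq a ha
          rcases List.mem_append.1 hq with hq | hq
          · exact hinit.color q hq a ha
          · rw [List.mem_singleton.1 hq] at ha ⊢
            exact hR.color _ hmem a (mem_of_mem_erase ha)
        · have hc := List.isChain_append.1 hR.chain
          refine List.isChain_append.2 ⟨hc.1, List.isChain_singleton _, ?_⟩
          simpa using hc.2.2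
    have hhead : ∀ a ∈ (runLetters X T Rs).getLast?, a.1 ≠ ε k := by
      have hc := (List.isChain_append.1 hR.chain).2.2
      rcases List.eq_nil_or_concat' Rs with rfl | ⟨Rs, q, rfl⟩
      · simp [runLetters]
      · simpa [runLetters] using hc q (by simp) (ε k, I) (by simp)
    have hop : nodeOp X χ ε T k = rightOp X (ε k) (T (ε k) k) := by
      rw [nodeOp, hχ]
    rw [centered_concat, h2, empty_union, hlet]
    conv_lhs => enter [1]; rw [hI]
    rw [centered_wordVec_insert X χ ε T _ Rs _ hge, h1, hop, rightOp_mul_incl X _ _ hhead,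
      ← blockVec_insert X T (ε k) fun b hb => hge b (mem_union_left _ hb), ← hI,
      incl_apply, mul_add, mul_smul_comm, mul_one, add_sub_cancel_left]

theorem algebraMapInv_letter (δ : Bool) (y : (X δ).red) :
    TensorAlgebra.algebraMapInv (letter X δ y) = 0 := by
  simp [letter, TensorAlgebra.algebraMapInv]

/-- The centred sums of the moments in the free product vanish. -/
theorem centered_vacuum_eq_zero {Rs : List (Bool × Finset (Fin n))}
    (hR : IsRuns (nodeKey χ) ε Rs) (hne : Rs ≠ []) :
    centered (fun p => (X p.1).state (blockVec X T p.1 p.2))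
      (fun V => TensorAlgebra.algebraMapInv (wordVec X χ ε T V)) Rs ∅ = 0 := by
  have h := congrArg (TensorAlgebra.algebraMapInv (R := ℂ)).toLinearMap
    (centered_wordVec X χ ε T Rs hR)
  rw [centered_map] at h
  refine h.trans ?_
  obtain ⟨p, Rs, rfl⟩ := List.exists_cons_of_ne_nil hne
  simp [runLetters, tensor_cons, algebraMapInv_letter]

/-- The representations are restrictions of operators on the whole tensor algebra, so vacuum
expectations can be computed there, without carrying membership in `freeProd`. -/
theorem vacuumState_prod (L : List (Module.End ℂ (FockAlg X) × Module.End ℂ (freeProd X)))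
    (hL : ∀ p ∈ L, ∀ v, (p.2 v : FockAlg X) = p.1 v) :
    vacuumState X (L.map Prod.snd).prod =
      TensorAlgebra.algebraMapInv ((L.map Prod.fst).prod (1 : FockAlg X)) := by
  rw [vacuumState]
  congr 1
  induction L with
  | nil => rfl
  | cons p L ih =>
    rw [List.map_cons, List.map_cons, List.prod_cons, List.prod_cons, Module.End.mul_apply,
      Module.End.mul_apply, hL p List.mem_cons_self,
      ih fun q hq => hL q (List.mem_cons_of_mem _ hq)]

end FreeProductMoments

/-! ### Vanishing of mixed cumulants and additivity -/

section Additivity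

variable {I J : Type*} {A : Type w} [Ring A] [Algebra ℂ A]

/-- The cumulants of a tuple with entries from two bi-free families: a block with entries from
one family contributes the cumulant of this family, any other block contributes zero. -/
noncomputable def mixedCumulant (φ : A →ₗ[ℂ] ℂ) (z' z'' : I ⊕ J → A) {n : ℕ}
    (α : Fin n → I ⊕ J) (ε : Fin n → Bool) (W : Finset (Fin n)) : ℂ :=
  if ∀ k ∈ W, ε k = false then blockCumulant φ (faceOf ∘ α) (z' ∘ α) W
  else if ∀ k ∈ W, ε k = true then blockCumulant φ (faceOf ∘ α) (z'' ∘ α) W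
  else 0

theorem mixedCumulant_of_color (φ : A →ₗ[ℂ] ℂ) (z' z'' : I ⊕ J → A) {n : ℕ}
    (α : Fin n → I ⊕ J) {ε : Fin n → Bool} {W : Finset (Fin n)} (hW : W.Nonempty) {δ : Bool}
    (h : ∀ k ∈ W, ε k = δ) :
    mixedCumulant φ z' z'' α ε W =
      blockCumulant φ (faceOf ∘ α) ((bif δ then z'' else z') ∘ α) W := by
  obtain ⟨k, hk⟩ := hW
  cases δ
  · rw [mixedCumulant, if_pos h]
    rfl
  · rw [mixedCumulant, if_neg fun h' => Bool.noConfusion ((h k hk).symm.trans (h' k hk)),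
      if_pos h]
    rfl

theorem mixedCumulant_eq_zero (φ : A →ₗ[ℂ] ℂ) (z' z'' : I ⊕ J → A) {n : ℕ}
    (α : Fin n → I ⊕ J) (ε : Fin n → Bool) (W : Finset (Fin n))
    (h : ∃ a ∈ W, ∃ b ∈ W, ε a ≠ ε b) : mixedCumulant φ z' z'' α ε W = 0 := by
  obtain ⟨a, ha, b, hb, hab⟩ := h
  rw [mixedCumulant, if_neg fun h => hab ((h a ha).trans (h b hb).symm),
    if_neg fun h => hab ((h a ha).trans (h b hb).symm)]

theorem centered_congr_weight {ι M : Type*} [DecidableEq ι] [AddCommGroup M] [Module ℂ M]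
    {f g : Bool × Finset ι → ℂ} (h : Finset ι → M) (Rs : List (Bool × Finset ι)) : ∀ B,
    (∀ p ∈ Rs, f p = g p) → centered f h Rs B = centered g h Rs B := by
  induction Rs with
  | nil => exact fun _ _ => rfl
  | cons p Rs ih =>
    intro B hfg
    simp only [centered]
    rw [hfg p List.mem_cons_self, ih _ fun q hq => hfg q (List.mem_cons_of_mem _ hq),
      ih _ fun q hq => hfg q (List.mem_cons_of_mem _ hq)]

/-- The mixed moments of a bi-free pair: the moment-cumulant formula with vanishing mixed
cumulants. -/
theorem blockMoment_eq_ncSum_mixedCumulant {φ : A →ₗ[ℂ] ℂ} (hφ : φ 1 = 1)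
    {z' z'' : I ⊕ J → A} (hz : BiFree φ z' z'') {n : ℕ} (α : Fin n → I ⊕ J) (ε : Fin n → Bool)
    (V : Finset (Fin n)) :
    blockMoment φ (fun k => (bif ε k then z'' else z') (α k)) V =
      ncSum (nodeKey (faceOf ∘ α)) (mixedCumulant φ z' z'' α ε) V := by
  obtain ⟨X, l, r, hw⟩ := hz
  obtain ⟨χ, hχ⟩ : ∃ χ, χ = faceOf ∘ α := ⟨_, rfl⟩
  let T : ∀ δ, Fin n → Module.End ℂ (X δ) := fun δ k =>
    Sum.elim (fun i => l δ (FreeAlgebra.ι ℂ i)) (fun j => r δ (FreeAlgebra.ι ℂ j)) (α k)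
  -- Bi-freeness replaces the mixed moments by vacuum expectations in the free product.
  have hmom : ∀ U, blockMoment φ (fun k => (bif ε k then z'' else z') (α k)) U =
      TensorAlgebra.algebraMapInv (wordVec X χ ε T U) := by
    intro U
    have h := hw ((U.sort (· ≤ ·)).map fun k => (ε k, α k))
    rw [List.map_map, List.map_map] at h
    rw [blockMoment_eq_orderedProd]
    refine h.trans ?_
    have h2 := vacuumState_prod X ((U.sort (· ≤ ·)).map fun k => (nodeOp X χ ε T k,
      Sum.elim (fun i => leftRep X (ε k) (l (ε k) (FreeAlgebra.ι ℂ i)))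
        (fun j => rightRep X (ε k) (r (ε k) (FreeAlgebra.ι ℂ j))) (α k))) ?_
    · rw [List.map_map, List.map_map] at h2
      exact h2
    · intro p hp v
      obtain ⟨k, -, rfl⟩ := List.mem_map.1 hp
      cases hk : α k with
      | inl i =>
        have hf : χ k = Face.left := by rw [hχ, Function.comp_apply, hk]; rfl
        simp only [nodeOp, hf, T, hk]
        rfl
      | inr j =>
        have hf : χ k = Face.right := by rw [hχ, Function.comp_apply, hk]; rfl
        simp only [nodeOp, hf, T, hk]
        rfl
  have hempty : blockMoment φ (fun k => (bif ε k then z'' else z') (α k)) ∅ = 1 := by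
    rw [blockMoment_eq_orderedProd, orderedProd_empty, hφ]
  have hc : ∀ Rs, IsRuns (nodeKey χ) ε Rs → Rs ≠ [] →
      centered (fun p => (X p.1).state (blockVec X T p.1 p.2))
        (blockMoment φ (fun k => (bif ε k then z'' else z') (α k))) Rs ∅ = 0 := by
    intro Rs hR hne
    rw [funext hmom]
    exact centered_vacuum_eq_zero X χ ε T hR hne
  rw [← hχ]
  refine eq_of_centered_eq (nodeKey_injective χ) ε
    (fun p => (X p.1).state (blockVec X T p.1 p.2)) (hempty.trans (ncSum_empty _ _).symm)
    (fun Rs hR hne => ?_) V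
  -- The two alternating sums vanish with different weights: the state of the vector of a run, and
  -- the `ncSum` of that run. It remains to see that these weights agree.
  rw [hc Rs hR hne, ← centered_ncSum_eq_zero (mixedCumulant_eq_zero φ z' z'' α ε) hR hne]
  refine (centered_congr_weight _ Rs ∅ fun p hp => ?_).symm
  -- The condition for the single run `p` says that its weight is the moment of `p`. Only one of the
  -- families occurs in it, so the moment-cumulant formula of that family applies.
  have h1 := hc [p] ⟨List.pairwise_singleton _ _,
    fun q hq => List.mem_singleton.1 hq ▸ hR.nonempty p hp,
    fun q hq => List.mem_singleton.1 hq ▸ hR.color p hp, List.isChain_singleton _⟩ (by simp)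
  simp only [centered, hempty, empty_union, smul_eq_mul, mul_one] at h1
  rw [← sub_eq_zero.1 h1]
  have h2 : blockMoment φ (fun k => (bif ε k then z'' else z') (α k)) p.2 =
      blockMoment φ ((bif p.1 then z'' else z') ∘ α) p.2 := by
    rw [blockMoment_eq_orderedProd, blockMoment_eq_orderedProd]
    refine congrArg φ (orderedProd_congr fun k hk => ?_)
    rw [hR.color p hp k hk]
    rfl
  rw [h2, blockMoment_eq_ncSum φ χ _ (hR.nonempty p hp)]
  refine ncSum_congr fun W hW hWn => ?_
  rw [mixedCumulant_of_color φ z' z'' α hWn fun k hk => hR.color p hp k (hW hk), hχ]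

/-- Expansion of a product of sums over the blocks of a partition. -/
theorem sum_prod_mixed {n : ℕ} {S : Finset (Finset (Fin n))} {key : Fin n → ℤ}
    (hS : IsNCPartition key univ S) (κ κ' : Finset (Fin n) → ℂ) :
    ∑ s : Finset (Fin n), ∏ W ∈ S,
      (if W ⊆ s then κ W else if Disjoint W s then κ' W else 0) = ∏ W ∈ S, (κ W + κ' W) := by
  rw [prod_add]
  symm
  -- A colouring with non-zero product is constant on every block, so it amounts to a choice of a
  -- set `U` of blocks, namely those inside `s`.
  have hiff : ∀ U ⊆ S, ∀ W ∈ S, (W ⊆ U.biUnion id ↔ W ∈ U) ∧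
      (Disjoint W (U.biUnion id) ↔ W ∉ U) := by
    intro U hU W hW
    obtain ⟨a, ha⟩ := hS.nonempty W hW
    have h1 : W ∈ U → W ⊆ U.biUnion id := fun h => subset_biUnion_of_mem id h
    have h2 : W ∉ U → Disjoint W (U.biUnion id) := by
      intro h
      refine disjoint_left.2 fun b hb hb' => h ?_
      obtain ⟨W', hW', hbW'⟩ := mem_biUnion.1 hb'
      rwa [hS.eq_of_mem W hW W' (hU hW') b hb hbW']
    refine ⟨⟨fun h => ?_, h1⟩, ⟨fun h hWU => ?_, h2⟩⟩
    · by_contra hWU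
      exact disjoint_left.1 (h2 hWU) ha (h ha)
    · exact disjoint_left.1 h ha (h1 hWU ha)
  refine sum_of_injOn (fun U => U.biUnion id) ?_ (fun _ _ => mem_coe.2 (mem_univ _)) ?_ ?_
  · intro U hU U' hU' he
    rw [mem_coe, mem_powerset] at hU hU'
    ext W
    constructor
    · intro h
      refine ((hiff U' hU' W (hU h)).1).1 ?_
      exact (((hiff U hU W (hU h)).1).2 h).trans he.subset
    · intro h
      refine ((hiff U hU W (hU' h)).1).1 ?_
      exact (((hiff U' hU' W (hU' h)).1).2 h).trans he.symm.subset
  · intro s _ hs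
    by_contra hprod
    refine hs ⟨S.filter (· ⊆ s), mem_coe.2 (mem_powerset.2 (filter_subset _ _)), ?_⟩
    ext a
    simp only [mem_biUnion, mem_filter, id_eq]
    constructor
    · rintro ⟨W, ⟨-, hW⟩, ha⟩
      exact hW ha
    · intro ha
      obtain ⟨W, hW, haW⟩ := hS.cover a (mem_univ a)
      refine ⟨W, ⟨hW, ?_⟩, haW⟩
      by_contra hWs
      refine hprod (prod_eq_zero hW ?_)
      rw [if_neg hWs, if_neg fun hd => disjoint_left.1 hd haW ha]
  · intro U hU
    rw [mem_powerset] at hU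
    rw [← prod_sdiff hU, mul_comm]
    congr 1
    · refine prod_congr rfl fun W hW => ?_
      rw [mem_sdiff] at hW
      rw [if_neg fun h => hW.2 ((hiff U hU W hW.1).1.1 h), if_pos ((hiff U hU W hW.1).2.2 hW.2)]
    · exact prod_congr rfl fun W hW => (if_pos ((hiff U hU W (hU hW)).1.2 hW)).symm

/-- The moments of the sum of a bi-free pair. -/
theorem moment_add_eq_ncSum {φ : A →ₗ[ℂ] ℂ} (hφ : φ 1 = 1) {z' z'' : I ⊕ J → A}
    (hz : BiFree φ z' z'') {n : ℕ} (α : Fin n → I ⊕ J) :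
    moment φ ((z' + z'') ∘ α) = ncSum (nodeKey (faceOf ∘ α)) (fun W =>
      blockCumulant φ (faceOf ∘ α) (z' ∘ α) W + blockCumulant φ (faceOf ∘ α) (z'' ∘ α) W)
        univ := by
  -- Multilinear expansion: `s` is the set of positions taken from `z'`, which has the shade
  -- `false`.
  have h1 : moment φ ((z' + z'') ∘ α) = ∑ s : Finset (Fin n),
      blockMoment φ (fun k => (bif decide (k ∉ s) then z'' else z') (α k)) univ := by
    have h := (MultilinearMap.mkPiAlgebraFin ℂ n A).map_add_univ (z' ∘ α) (z'' ∘ α)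
    simp only [MultilinearMap.mkPiAlgebraFin_apply] at h
    rw [moment]
    refine (congrArg φ h).trans ?_
    rw [map_sum]
    refine sum_congr rfl fun s _ => ?_
    rw [blockMoment_eq_orderedProd, orderedProd, Fin.sort_univ, ← List.ofFn_eq_map]
    congr 3
    funext k
    by_cases hk : k ∈ s <;> simp [hk]
  rw [h1, sum_congr rfl fun s _ => blockMoment_eq_ncSum_mixedCumulant hφ hz α _ univ]
  simp only [ncSum]
  rw [sum_comm]
  refine sum_congr rfl fun S hS => ?_
  rw [mem_ncPartitions] at hS
  rw [← sum_prod_mixed hS]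
  refine sum_congr rfl fun s _ => prod_congr rfl fun W _ => ?_
  simp only [mixedCumulant, decide_eq_false_iff_not, not_not, decide_eq_true_eq, subset_iff,
    disjoint_left]

/-- The bi-free cumulants are additive on bi-free pairs. -/
theorem cumulant_add {φ : A →ₗ[ℂ] ℂ} (hφ : φ 1 = 1) {z' z'' : I ⊕ J → A}
    (hz : BiFree φ z' z'') (n : ℕ) (α : Fin n → I ⊕ J) (hn : n ≠ 0) :
    cumulant φ n (faceOf ∘ α) ((z' + z'') ∘ α) =
      cumulant φ n (faceOf ∘ α) (z' ∘ α) + cumulant φ n (faceOf ∘ α) (z'' ∘ α) := by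
  induction n using Nat.strong_induction_on with
  | _ n ih =>
  have : NeZero n := ⟨hn⟩
  have h := (moment_eq_ncSum φ n (faceOf ∘ α) ((z' + z'') ∘ α)).symm.trans
    (moment_add_eq_ncSum hφ hz α)
  have hmem : {univ} ∈ ncPartitions (nodeKey (faceOf ∘ α)) univ := by
    rw [mem_ncPartitions, ← parts_oneBNC (faceOf ∘ α)]
    exact isNCPartition_parts _
  rw [ncSum, ncSum, ← add_sum_erase _ _ hmem, ← add_sum_erase _ _ hmem, prod_singleton,
    prod_singleton, blockCumulant_univ, blockCumulant_univ, blockCumulant_univ] at h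
  -- In the two expansions of the moment of the sum, all partitions but the one-block partition have
  -- only smaller blocks and contribute equally by induction; so the one-block terms are equal as
  -- well.
  refine add_right_cancel (h.trans (congrArg _ (sum_congr rfl fun S hS => ?_)))
  rw [mem_erase, mem_ncPartitions] at hS
  refine prod_congr rfl fun W hW => ?_
  have hWu : W ≠ univ := by
    rintro rfl
    refine hS.1 (eq_singleton_iff_unique_mem.2 ⟨hW, fun W hW' => ?_⟩)
    obtain ⟨a, ha⟩ := hS.2.nonempty W hW'
    exact hS.2.eq_of_mem W hW' _ hW a ha (mem_univ a)
  have hcard : W.card < n := by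
    simpa using (card_lt_iff_ne_univ W).2 hWu
  exact (ih W.card hcard (restrictTo α W) (hS.2.nonempty W hW).card_pos.ne').symm

end Additivity

/-! ### The universal polynomial: its defining properties -/

section UniversalPolynomial

variable {I J : Type*}

theorem evalMoments_eq_eval_blockMoment {A : Type*} [Ring A] [Algebra ℂ A] {n : ℕ}
    (α : Fin n → I ⊕ J) (φ : A →ₗ[ℂ] ℂ) (z : I ⊕ J → A)
    (P : MvPolynomial (NonemptySubset n) ℂ) :
    evalMoments α φ z P = MvPolynomial.eval (fun K => blockMoment φ (z ∘ α) K.1) P := rfl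

theorem isWeightedHomogeneous_RPoly {n : ℕ} (α : Fin n → I ⊕ J) :
    (RPoly α).IsWeightedHomogeneous (cardWeight n) n := by
  refine MvPolynomial.IsWeightedHomogeneous.sum _ _ _ fun π _ => ?_
  refine MvPolynomial.IsWeightedHomogeneous.C_mul ?_ _
  have h := MvPolynomial.IsWeightedHomogeneous.prod (w := cardWeight n) (R := ℂ) univ
    (fun V : {V : Finset (Fin n) // V ∈ π.1.parts} =>
      MvPolynomial.X ⟨V.1, π.1.nonempty_of_mem_parts V.2⟩) (fun V => V.1.card)
    fun V _ => MvPolynomial.isWeightedHomogeneous_X ℂ (cardWeight n) _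
  have hsum : ∑ V : {V : Finset (Fin n) // V ∈ π.1.parts}, V.1.card = n := by
    rw [Finset.sum_coe_sort π.1.parts card, π.1.sum_card_parts, card_univ, Fintype.card_fin]
  rwa [hsum] at h

theorem evalMoments_RPoly {A : Type*} [Ring A] [Algebra ℂ A] {n : ℕ} [NeZero n]
    (α : Fin n → I ⊕ J) (φ : A →ₗ[ℂ] ℂ) (z : I ⊕ J → A) :
    evalMoments α φ z (RPoly α) = cumulant φ n (faceOf ∘ α) (z ∘ α) := by
  rw [cumulant_eq_sum_muBNC, evalMoments_eq_eval_blockMoment, RPoly, map_sum]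
  refine sum_congr rfl fun π _ => ?_
  rw [map_mul, MvPolynomial.eval_C, map_prod]
  simp only [MvPolynomial.eval_X]
  rw [Finset.prod_coe_sort π.1.parts (blockMoment φ (z ∘ α))]

theorem exists_leading {n : ℕ} [NeZero n] {R : MvPolynomial (NonemptySubset n) ℂ}
    (hRh : R.IsWeightedHomogeneous (cardWeight n) n)
    (h : R - MvPolynomial.X ⟨univ, univ_nonempty⟩ ∈
      MvPolynomial.supported ℂ {K : NonemptySubset n | K.1 ≠ univ}) :
    ∃ Q ∈ MvPolynomial.supported ℂ {K : NonemptySubset n | K.1 ≠ univ},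
      R = MvPolynomial.X ⟨univ, univ_nonempty⟩ + Q ∧
        Q.IsWeightedHomogeneous (cardWeight n) n := by
  have hX : (MvPolynomial.X ⟨univ, univ_nonempty⟩ :
      MvPolynomial (NonemptySubset n) ℂ).IsWeightedHomogeneous (cardWeight n) n := by
    have h := MvPolynomial.isWeightedHomogeneous_X ℂ (cardWeight n) ⟨univ, univ_nonempty⟩
    have hw : cardWeight n ⟨univ, univ_nonempty⟩ = n := by
      simp only [cardWeight, card_univ, Fintype.card_fin]
    rwa [hw] at h
  exact ⟨_, h, (add_sub_cancel _ _).symm, hRh.sub hX⟩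

/-- The maximum of `BNC` contributes the leading indeterminate with coefficient `μ(1, 1) = 1`; every
other partition has proper blocks only. -/
theorem RPoly_sub_X_mem_supported {n : ℕ} [NeZero n] (α : Fin n → I ⊕ J) :
    RPoly α - MvPolynomial.X ⟨univ, univ_nonempty⟩ ∈
      MvPolynomial.supported ℂ {K : NonemptySubset n | K.1 ≠ univ} := by
  rw [RPoly, ← add_sum_erase _ _ (mem_univ (oneBNC (faceOf ∘ α)))]
  have h1 : MvPolynomial.C (muBNC (faceOf ∘ α) (oneBNC (faceOf ∘ α)) (oneBNC (faceOf ∘ α))) *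
      ∏ V : {V : Finset (Fin n) // V ∈ (oneBNC (faceOf ∘ α)).1.parts},
        MvPolynomial.X ⟨V.1, (oneBNC (faceOf ∘ α)).1.nonempty_of_mem_parts V.2⟩ =
      (MvPolynomial.X ⟨univ, univ_nonempty⟩ : MvPolynomial (NonemptySubset n) ℂ) := by
    have hp := parts_oneBNC (faceOf ∘ α)
    rw [muBNC, IncidenceAlgebra.mu_self, map_one, one_mul,
      Fintype.prod_eq_single ⟨univ, by rw [hp]; exact mem_singleton_self _⟩]
    intro V hV
    refine absurd (Subtype.ext ?_) hV
    exact mem_singleton.1 (hp.subset V.2)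
  rw [h1, add_sub_cancel_left]
  refine sum_mem fun π hπ => mul_mem ?_ (prod_mem fun V _ => ?_)
  · exact Subalgebra.algebraMap_mem _ _
  · rw [MvPolynomial.X_mem_supported]
    intro hV
    have h := card_lt_of_ne_oneBNC (mem_erase.1 hπ).1 V.2
    rw [show V.1 = univ from hV, card_univ, Fintype.card_fin] at h
    exact lt_irrefl _ h

theorem hasCumulantProperty_RPoly {n : ℕ} [NeZero n] (α : Fin n → I ⊕ J) :
    HasCumulantProperty.{w} α (RPoly α) := by
  intro A _ _ φ hφ z' z'' hz
  rw [evalMoments_RPoly, evalMoments_RPoly, evalMoments_RPoly]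
  exact cumulant_add hφ hz n α (NeZero.ne n)

theorem isUniversalCumulantPolynomial_RPoly {n : ℕ} [NeZero n] (α : Fin n → I ⊕ J) :
    IsUniversalCumulantPolynomial.{w} α (RPoly α) :=
  ⟨exists_leading (isWeightedHomogeneous_RPoly α) (RPoly_sub_X_mem_supported α), isWeightedHomogeneous_RPoly α, hasCumulantProperty_RPoly α⟩

/-! ### Uniqueness by doubling the cumulants -/

/-- Every two-faced family has two bi-free copies. -/
theorem exists_biFree_copies {A : Type w} [Ring A] [Algebra ℂ A] (φ : A →ₗ[ℂ] ℂ)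
    (hφ : φ 1 = 1) (z : I ⊕ J → A) :
    ∃ (B : Type w) (_ : Ring B) (_ : Algebra ℂ B) (ψ : B →ₗ[ℂ] ℂ) (z' z'' : I ⊕ J → B),
      ψ 1 = 1 ∧ BiFree ψ z' z'' ∧
      (∀ L : List (I ⊕ J), ψ (L.map z').prod = φ (L.map z).prod) ∧
      ∀ L : List (I ⊕ J), ψ (L.map z'').prod = φ (L.map z).prod := by
  let X : Bool → PointedSpace.{w} := fun _ =>
    { carrier := A, vec := 1, state := φ, state_vec := hφ }
  -- Both faces act on the space `A`, with state-vector `1`, by left multiplication. The faces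
  -- differ only in the representation on the free product, and on vectors of length at most one the
  -- two representations agree, so a word in one copy just builds up its product in `A`.
  let m : ∀ ε : Bool, A →ₐ[ℂ] Module.End ℂ (X ε) := fun _ => Algebra.lmul ℂ A
  let Z : Bool → I ⊕ J → Module.End ℂ (freeProd X) := fun ε =>
    Sum.elim (fun i => leftRep X ε (m ε (z (Sum.inl i))))
      (fun j => rightRep X ε (m ε (z (Sum.inr j))))
  let ψ : Module.End ℂ (freeProd X) →ₗ[ℂ] ℂ :=
    (TensorAlgebra.algebraMapInv (R := ℂ)).toLinearMap ∘ₗ (freeProd X).subtype ∘ₗ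
      LinearMap.applyₗ (vacuum X)
  have hψ : ∀ S, ψ S = vacuumState X S := fun _ => rfl
  have hvec : ∀ (ε : Bool) (L : List (I ⊕ J)),
      ((L.map (Z ε)).prod (vacuum X) : FockAlg X) = incl X ε ((L.map z).prod : A) := by
    intro ε L
    induction L with
    | nil => exact (incl_vec X ε).symm
    | cons k L ih =>
      rw [List.map_cons, List.map_cons, List.prod_cons, List.prod_cons, Module.End.mul_apply]
      cases k with
      | inl i =>
        have h := leftOp_incl_mul X (ε := ε) (m ε (z (Sum.inl i))) ((L.map z).prod : A) (L := [])
          (by simp)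
        rw [tensor_nil, mul_one, mul_one, ← ih] at h
        exact h
      | inr j =>
        have h := rightOp_mul_incl X (ε := ε) (m ε (z (Sum.inr j))) ((L.map z).prod : A) (L := [])
          (by simp)
        rw [tensor_nil, one_mul, one_mul, ← ih] at h
        exact h
  have hmom : ∀ (ε : Bool) (L : List (I ⊕ J)), ψ (L.map (Z ε)).prod = φ (L.map z).prod := by
    intro ε L
    rw [hψ, vacuumState, hvec, incl_apply, map_add, map_smul, map_one, algebraMapInv_letter,
      smul_eq_mul, mul_one, add_zero]
  refine ⟨Module.End ℂ (freeProd X), inferInstance, inferInstance, ψ, Z false, Z true, ?_, ?_,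
    hmom false, hmom true⟩
  · rw [hψ, vacuumState, Module.End.one_apply]
    exact map_one _
  · refine ⟨X, fun ε => (m ε).comp (FreeAlgebra.lift ℂ fun i => z (Sum.inl i)),
      fun ε => (m ε).comp (FreeAlgebra.lift ℂ fun j => z (Sum.inr j)), fun word => ?_⟩
    rw [hψ]
    congr 2
    refine List.map_congr_left fun q _ => ?_
    obtain ⟨ε, k⟩ := q
    cases ε <;> cases k <;> simp [Z]

theorem blockMoment_comp_eq {A B : Type*} [Ring A] [Algebra ℂ A] [Ring B] [Algebra ℂ B]
    {φ : A →ₗ[ℂ] ℂ} {ψ : B →ₗ[ℂ] ℂ} {z : I ⊕ J → A} {z' : I ⊕ J → B}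
    (h : ∀ L : List (I ⊕ J), ψ (L.map z').prod = φ (L.map z).prod) {n : ℕ} (α : Fin n → I ⊕ J)
    (V : Finset (Fin n)) : blockMoment ψ (z' ∘ α) V = blockMoment φ (z ∘ α) V := by
  rw [blockMoment_eq_orderedProd, blockMoment_eq_orderedProd, orderedProd, orderedProd,
    ← List.map_map, ← List.map_map, h]

theorem cumulant_comp_eq {A B : Type*} [Ring A] [Algebra ℂ A] [Ring B] [Algebra ℂ B]
    {φ : A →ₗ[ℂ] ℂ} {ψ : B →ₗ[ℂ] ℂ} {z : I ⊕ J → A} {z' : I ⊕ J → B}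
    (h : ∀ L : List (I ⊕ J), ψ (L.map z').prod = φ (L.map z).prod) {n : ℕ} (hn : n ≠ 0)
    (α : Fin n → I ⊕ J) :
    cumulant ψ n (faceOf ∘ α) (z' ∘ α) = cumulant φ n (faceOf ∘ α) (z ∘ α) := by
  have : NeZero n := ⟨hn⟩
  rw [cumulant_eq_sum_muBNC, cumulant_eq_sum_muBNC]
  simp only [blockMoment_comp_eq h]

/-- There are families with `2 ^ k` times the cumulants of a given one; a polynomial with the
cumulant property is multiplied by `2 ^ k` as well. -/
theorem exists_pow_two_smul_cumulant {n : ℕ} (α : Fin n → I ⊕ J)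
    {D : MvPolynomial (NonemptySubset n) ℂ} (hD : HasCumulantProperty.{w} α D)
    {A : Type w} [Ring A] [Algebra ℂ A] (φ : A →ₗ[ℂ] ℂ) (hφ : φ 1 = 1) (z : I ⊕ J → A) (k : ℕ) :
    ∃ (B : Type w) (_ : Ring B) (_ : Algebra ℂ B) (ψ : B →ₗ[ℂ] ℂ) (y : I ⊕ J → B), ψ 1 = 1 ∧
      (∀ (m : ℕ) (β : Fin m → I ⊕ J), m ≠ 0 →
        cumulant ψ m (faceOf ∘ β) (y ∘ β) = 2 ^ k * cumulant φ m (faceOf ∘ β) (z ∘ β)) ∧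
      evalMoments α ψ y D = 2 ^ k * evalMoments α φ z D := by
  induction k with
  | zero => exact ⟨A, inferInstance, inferInstance, φ, z, hφ, by simp, by simp⟩
  | succ k ih =>
    obtain ⟨B, _, _, ψ, y, hψ, hc, he⟩ := ih
    obtain ⟨C, _, _, θ, y', y'', hθ, hfree, h', h''⟩ := exists_biFree_copies ψ hψ y
    refine ⟨C, inferInstance, inferInstance, θ, y' + y'', hθ, fun m β hm => ?_, ?_⟩
    · rw [cumulant_add hθ hfree m β hm, cumulant_comp_eq h' hm, cumulant_comp_eq h'' hm,
        hc m β hm]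
      ring
    · rw [hD C θ hθ y' y'' hfree]
      simp only [evalMoments_eq_eval_blockMoment, blockMoment_comp_eq h',
        blockMoment_comp_eq h''] at he ⊢
      rw [he]
      ring

/-- A weighted homogeneous polynomial without linear terms vanishes to second order where the
indeterminates vanish to first order. -/
theorem X_sq_dvd_aeval {n : ℕ} [NeZero n] {D : MvPolynomial (NonemptySubset n) ℂ}
    (hsupp : D ∈ MvPolynomial.supported ℂ {K : NonemptySubset n | K.1 ≠ univ})
    (hhom : D.IsWeightedHomogeneous (cardWeight n) n) (p : NonemptySubset n → Polynomial ℂ)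
    (hp : ∀ K, Polynomial.X ∣ p K) : Polynomial.X ^ 2 ∣ MvPolynomial.aeval p D := by
  rw [MvPolynomial.aeval_def, MvPolynomial.eval₂_eq]
  refine dvd_sum fun d hd => Dvd.dvd.mul_left ?_ _
  have hw := hhom (MvPolynomial.mem_support_iff.1 hd)
  -- A monomial of weight `n ≥ 1` is not constant, and a single indeterminate of weight `n` would be
  -- the one of the full set, which does not occur.
  have hdeg : 2 ≤ ∑ K ∈ d.support, d K := by
    have hn := NeZero.ne n
    rw [Finsupp.weight_apply, Finsupp.sum] at hw
    by_contra! hlt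
    have hne : d.support.Nonempty := by
      rw [nonempty_iff_ne_empty]
      intro h
      rw [h, sum_empty] at hw
      exact hn hw.symm
    obtain ⟨K, hK⟩ := hne
    have hsplit := add_sum_erase d.support (fun K => d K) hK
    have hK1 : 1 ≤ d K := Nat.one_le_iff_ne_zero.2 (Finsupp.mem_support_iff.1 hK)
    have hrest : ∀ K' ∈ d.support.erase K, d K' = 0 := by
      rw [← sum_eq_zero_iff]
      omega
    have hdK : d K = 1 := by omega
    rw [← add_sum_erase d.support _ hK, sum_eq_zero fun K' hK' => by rw [hrest K' hK', zero_smul],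
      hdK, add_zero, one_smul] at hw
    have hvars : K ∈ D.vars := (MvPolynomial.mem_vars_iff_mem_support K).2 ⟨d, hd, hK⟩
    refine MvPolynomial.mem_supported.1 hsupp (mem_coe.2 hvars) (eq_univ_of_card K.1 ?_)
    rw [Fintype.card_fin]
    exact hw
  refine (pow_dvd_pow _ hdeg).trans ?_
  rw [← prod_pow_eq_pow_sum]
  exact prod_dvd_prod_of_dvd _ _ fun K _ => pow_dvd_pow_of_dvd (hp K) _

/-- A polynomial with the cumulant property and without linear terms vanishes on all moments. -/
theorem evalMoments_eq_zero {n : ℕ} [NeZero n] (α : Fin n → I ⊕ J)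
    {D : MvPolynomial (NonemptySubset n) ℂ}
    (hsupp : D ∈ MvPolynomial.supported ℂ {K : NonemptySubset n | K.1 ≠ univ})
    (hhom : D.IsWeightedHomogeneous (cardWeight n) n) (hD : HasCumulantProperty.{w} α D)
    {A : Type w} [Ring A] [Algebra ℂ A] (φ : A →ₗ[ℂ] ℂ) (hφ : φ 1 = 1) (z : I ⊕ J → A) :
    evalMoments α φ z D = 0 := by
  obtain ⟨κ, hκ⟩ : ∃ κ, κ = blockCumulant φ (faceOf ∘ α) (z ∘ α) := ⟨_, rfl⟩
  -- The moments of a family whose cumulants are `t` times those of `z`, as polynomials in `t`. They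
  -- have no constant term, since a non-empty set has no partition without blocks.
  let p : NonemptySubset n → Polynomial ℂ := fun K =>
    ∑ S ∈ ncPartitions (nodeKey (faceOf ∘ α)) K.1,
      ∏ W ∈ S, (Polynomial.C (κ W) * Polynomial.X)
  have hp : ∀ K, Polynomial.X ∣ p K := by
    intro K
    refine dvd_sum fun S hS => ?_
    rw [mem_ncPartitions] at hS
    obtain ⟨a, ha⟩ := K.2
    obtain ⟨W, hW, -⟩ := hS.cover a ha
    exact (dvd_mul_left _ _).trans (dvd_prod_of_mem _ hW)
  have heval : ∀ k : ℕ, (MvPolynomial.aeval p D).eval (2 ^ k) =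
      2 ^ k * evalMoments α φ z D := by
    intro k
    obtain ⟨B, _, _, ψ, y, -, hc, he⟩ := exists_pow_two_smul_cumulant α hD φ hφ z k
    rw [← he, evalMoments_eq_eval_blockMoment]
    have h := MvPolynomial.comp_aeval_apply (R := ℂ) (f := p) (Polynomial.aeval ((2 : ℂ) ^ k)) D
    rw [Polynomial.coe_aeval_eq_eval] at h
    rw [h, MvPolynomial.aeval_eq_eval]
    congr 2
    funext K
    rw [blockMoment_eq_ncSum ψ (faceOf ∘ α) _ K.2]
    simp only [p, Polynomial.eval_finsetSum, Polynomial.eval_prod, Polynomial.eval_mul,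
      Polynomial.eval_C, Polynomial.eval_X]
    refine ncSum_congr (κ := fun W => κ W * 2 ^ k) fun W _ hW => ?_
    rw [hκ, mul_comm]
    exact (hc W.card (restrictTo α W) hW.card_pos.ne').symm
  -- The powers of `2` are infinitely many points, so the scaling law holds identically in `t`;
  -- divisibility by `t ^ 2` then kills the linear coefficient.
  have hlin : MvPolynomial.aeval p D = Polynomial.C (evalMoments α φ z D) * Polynomial.X := by
    refine Polynomial.eq_of_infinite_eval_eq _ _ ?_
    have hinj : Function.Injective fun k : ℕ => (2 : ℂ) ^ k := by
      intro a b hab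
      have hab' : (2 : ℂ) ^ a = 2 ^ b := hab
      exact Nat.pow_right_injective le_rfl (by exact_mod_cast hab')
    refine (Set.infinite_range_of_injective hinj).mono ?_
    rintro _ ⟨k, rfl⟩
    rw [Set.mem_ofPred_eq, heval, Polynomial.eval_mul, Polynomial.eval_C, Polynomial.eval_X, mul_comm]
  have hdvd := X_sq_dvd_aeval hsupp hhom p hp
  rw [hlin, Polynomial.X_pow_dvd_iff] at hdvd
  simpa using hdvd 1 one_lt_two

/-- If the indices are distinct, the moments can have arbitrary values. -/
theorem exists_blockMoment_eq {n : ℕ} {α : Fin n → I ⊕ J} (hα : Function.Injective α)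
    (x : NonemptySubset n → ℂ) :
    ∃ (A : Type w) (_ : Ring A) (_ : Algebra ℂ A) (φ : A →ₗ[ℂ] ℂ) (z : I ⊕ J → A), φ 1 = 1 ∧
      ∀ K : NonemptySubset n, blockMoment φ (z ∘ α) K.1 = x K := by
  classical
  -- On the free monoid algebra a functional can be prescribed on words: a word receives the value
  -- of its set of letters, the empty word the value `1`. The increasing words then realize `x`. The
  -- lift puts the algebra in the required universe.
  let c : FreeMonoid (ULift.{w} (Fin n)) → ℂ := fun u =>
    if h : (u.toList.map ULift.down).toFinset.Nonempty then x ⟨_, h⟩ else 1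
  let φ : MonoidAlgebra ℂ (FreeMonoid (ULift.{w} (Fin n))) →ₗ[ℂ] ℂ :=
    Finsupp.linearCombination ℂ c ∘ₗ (MonoidAlgebra.coeffLinearEquiv ℂ).toLinearMap
  have hφ : ∀ u, φ (MonoidAlgebra.of ℂ _ u) = c u := by
    intro u
    simp [φ, MonoidAlgebra.of]
  let g : Fin n → MonoidAlgebra ℂ (FreeMonoid (ULift.{w} (Fin n))) := fun k =>
    MonoidAlgebra.of ℂ _ (FreeMonoid.of ⟨k⟩)
  refine ⟨MonoidAlgebra ℂ (FreeMonoid (ULift.{w} (Fin n))), inferInstance, inferInstance, φ,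
    Function.extend α g 0, ?_, fun K => ?_⟩
  · rw [← map_one (MonoidAlgebra.of ℂ (FreeMonoid (ULift.{w} (Fin n)))), hφ]
    simp [c]
  · rw [Function.extend_comp hα, blockMoment_eq_orderedProd]
    have h : orderedProd g K.1 = MonoidAlgebra.of ℂ _
        (FreeMonoid.ofList ((K.1.sort (· ≤ ·)).map ULift.up)) := by
      rw [orderedProd]
      induction K.1.sort (· ≤ ·) with
      | nil => exact (map_one _).symm
      | cons k L ih =>
        rw [List.map_cons, List.prod_cons, ih, List.map_cons, FreeMonoid.ofList_cons, map_mul]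
    rw [h, hφ]
    have hK : ((FreeMonoid.ofList ((K.1.sort (· ≤ ·)).map ULift.up.{w})).toList.map
        ULift.down).toFinset = K.1 := by
      rw [FreeMonoid.toList_ofList, List.map_map]
      have : (ULift.down ∘ ULift.up.{w} : Fin n → Fin n) = id := rfl
      rw [this, List.map_id, sort_toFinset]
    have hc : c (FreeMonoid.ofList ((K.1.sort (· ≤ ·)).map ULift.up)) =
        if h : (((FreeMonoid.ofList ((K.1.sort (· ≤ ·)).map ULift.up.{w})).toList.map
        ULift.down).toFinset).Nonempty then x ⟨_, h⟩ else 1 := rfl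
    rw [hc, dif_pos (hK.symm ▸ K.2)]
    congr 1
    exact Subtype.ext hK

theorem evalMoments_eq_of_isUniversalCumulantPolynomial {n : ℕ} [NeZero n] {α : Fin n → I ⊕ J}
    {P R : MvPolynomial (NonemptySubset n) ℂ} (hP : IsUniversalCumulantPolynomial.{w} α P)
    (hR : IsUniversalCumulantPolynomial.{w} α R) {A : Type w} [Ring A] [Algebra ℂ A]
    (φ : A →ₗ[ℂ] ℂ) (hφ : φ 1 = 1) (z : I ⊕ J → A) :
    evalMoments α φ z P = evalMoments α φ z R := by
  obtain ⟨Q, hQ, hPQ, hQh⟩ := hP.leading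
  obtain ⟨Q', hQ', hRQ, hQh'⟩ := hR.leading
  -- The leading indeterminates cancel, and the cumulant property is linear in the polynomial.
  have hsub : P - R = Q - Q' := by rw [hPQ, hRQ, add_sub_add_left_eq_sub]
  have h := evalMoments_eq_zero α (D := P - R) (hsub ▸ sub_mem hQ hQ') (hsub ▸ hQh.sub hQh')
    (fun A _ _ φ hφ z' z'' hz => ?_) φ hφ z
  · rw [evalMoments, map_sub, sub_eq_zero] at h
    exact h
  · have h1 := hP.cumulant_property A φ hφ z' z'' hz
    have h2 := hR.cumulant_property A φ hφ z' z'' hz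
    simp only [evalMoments, map_sub] at h1 h2 ⊢
    rw [h1, h2]
    ring

end UniversalPolynomial

theorem mainTheorem8 {I J : Type*} {n : ℕ} [NeZero n] (α : Fin n → I ⊕ J) :
    (RPoly α).IsWeightedHomogeneous (cardWeight n) n ∧
    (∀ (A : Type w) [Ring A] [Algebra ℂ A] (φ : A →ₗ[ℂ] ℂ), φ 1 = 1 → ∀ z : I ⊕ J → A,
      evalMoments α φ z (RPoly α) = cumulant φ n (faceOf ∘ α) (z ∘ α)) ∧
    (∀ (A : Type w) [Ring A] [Algebra ℂ A] (φ : A →ₗ[ℂ] ℂ), φ 1 = 1 → ∀ z' z'' : I ⊕ J → A,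
      BiFree φ z' z'' →
        evalMoments α φ (z' + z'') (RPoly α) =
          evalMoments α φ z' (RPoly α) + evalMoments α φ z'' (RPoly α)) ∧
    IsUniversalCumulantPolynomial.{w} α (RPoly α) ∧
    (∀ P : MvPolynomial (NonemptySubset n) ℂ, IsUniversalCumulantPolynomial.{w} α P →
      (∀ (A : Type w) [Ring A] [Algebra ℂ A] (φ : A →ₗ[ℂ] ℂ), φ 1 = 1 → ∀ z : I ⊕ J → A,
        evalMoments α φ z P = evalMoments α φ z (RPoly α)) ∧
      (Function.Injective α → P = RPoly α)) := by
  have hR := isUniversalCumulantPolynomial_RPoly.{w} α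
  refine ⟨isWeightedHomogeneous_RPoly α, fun A _ _ φ _ z => evalMoments_RPoly α φ z,
    hasCumulantProperty_RPoly α, hR, fun P hP => ⟨fun A _ _ φ hφ z =>
      evalMoments_eq_of_isUniversalCumulantPolynomial hP hR φ hφ z, fun hα => ?_⟩⟩
  -- Over the infinite field `ℂ` it suffices to compare values, and for injective `α` every point is
  -- a point of moments.
  refine MvPolynomial.funext fun x => ?_
  obtain ⟨A, _, _, φ, z, hφ, hx⟩ := exists_blockMoment_eq.{w} hα x
  have h := evalMoments_eq_of_isUniversalCumulantPolynomial hP hR φ hφ z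
  rwa [evalMoments_eq_eval_blockMoment, evalMoments_eq_eval_blockMoment, funext hx] at h
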